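/- Let $(M,g)$ be a Riemannian manifold of dimension $2n+1$ with Levi-Civita connection $\nabla$ and an almost contact metric structure $(\varphi,\eta,\zeta)$: $\varphi$ is a field of endomorphisms of $TM$, $\eta$ a $1$-form and $\zeta$ the dual unit vector field, $\eta=g(\zeta,\cdot)$, with $$\varphi^2X=-X+\eta(X)\zeta,\qquad g(\varphi X,\varphi Y)=g(X,Y)-\eta(X)\eta(Y).$$ At each point let $\mathfrak{u}(n)\subset\mathfrak{so}(T_xM)$ be the algebra of skew-symmetric endomorphisms commuting with $\varphi$ and annihilating $\zeta$, let $\mathfrak{u}(n)^{\perp}$ be its orthogonal complement in $\mathfrak{so}(T_xM)$ with respect to the trace form $(A,C)\mapsto\operatorname{tr}(AC)$ (of which the Killing form is a multiple), and let $A_{\mathfrak{u}(n)^\perp}$ be the $\mathfrak{u}(n)^\perp$-component of $A\in\mathfrak{so}(T_xM)$. Let $\nabla^G$ be the $U(n)\times 1$-connection given by the $\mathfrak{u}(n)$-component of the connection form of $\nabla$, i.e. the connection with $\nabla^Gg=0$, $\nabla^G\varphi=0$, $\nabla^G\zeta=0$ whose difference $\xi_XY=\nabla^G_XY-\nabla_XY$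 (the intrinsic torsion) satisfies $\xi_X\in\mathfrak{u}(n)^\perp$ for all $X$. Put $\alpha(X,Y,Z)=g(\xi_XY,Z)$, $R(X,Y)=[\nabla_X,\nabla_Y]-\nabla_{[X,Y]}$ and, for any orthonormal basis $(f_a)_{1\le a\le 2n+1}$ of $T_xM$, $$s^{\rm alt}_{\mathfrak{u}(n)^\perp}=\sum_{a,b}g([\xi_{f_a},\xi_{f_b}]_{\mathfrak{u}(n)^\perp}f_b,f_a),\qquad s_{\mathfrak{u}(n)^\perp}=\sum_{a,b}g(R(f_a,f_b)_{\mathfrak{u}(n)^\perp}f_b,f_a),$$ $${\rm Ric}(X,Y)=\sum_a g(R(X,f_a)f_a,Y),\quad s=\sum_a{\rm Ric}(f_a,f_a),\quad s^{\ast}=\sum_{a,b}g(R(f_a,f_b)\varphi f_b,\varphi f_a).$$ For an orthonormal basis $(e_i)_{1\le i\le 2n}$ of $\ker\eta_x$ put (all indices from $1$ to $2n$) $$i_7=\sum_{j,k}\alpha(\zeta,e_j,e_k)\alpha(e_j,\zeta,e_k),\quad i_8=\sum_{i,j}\alpha(e_i,e_j,\zeta)\alpha(e_j,e_i,\zeta),\quad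 i_{10}=\sum_{i,j}\alpha(e_i,e_i,\zeta)\alpha(e_j,e_j,\zeta),$$ $$i_{12}=\sum_{i,j}\alpha(e_i,e_j,\zeta)\alpha(\varphi e_j,\varphi e_i,\zeta),\quad i_{14}=\sum_{i,j}\alpha(e_i,\varphi e_i,\zeta)\alpha(e_j,\varphi e_j,\zeta),\quad i_{17}=\sum_{i,k}\alpha(e_i,e_i,e_k)\alpha(\zeta,\zeta,e_k).$$ Then, at every point $x\in M$ and for every orthonormal basis $(e_i)$ of $\ker\eta_x$, $$s^{\rm alt}_{\mathfrak{u}(n)^\perp}=\tfrac12\,(i_8-i_{10}+i_{12}+i_{14})+2\,(i_7-i_{17})\qquad\text{and}\qquad s_{\mathfrak{u}(n)^\perp}=\tfrac12\,(s-s^{\ast})+{\rm Ric}(\zeta,\zeta).$$ -/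

import Mathlib

open scoped Manifold ContDiff Bundle InnerProductSpace
open Bundle

noncomputable section

namespace AlmostContact

/-! ### Linear algebra: the Lie algebras `so(V)`, `u(n)` and the complement of `u(n)` -/

section LinearAlgebra

variable {V : Type*} [NormedAddCommGroup V] [InnerProductSpace ℝ V]

/-- The skew-symmetric endomorphisms of `V`. -/
def so (V : Type*) [NormedAddCommGroup V] [InnerProductSpace ℝ V] :
    Submodule ℝ (Module.End ℝ V) where
  carrier := {A | ∀ v w, ⟪A v, w⟫_ℝ = -⟪v, A w⟫_ℝ}
  zero_mem' := by intro v w; simp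
  add_mem' := by
    intro A B hA hB v w
    simp only [LinearMap.add_apply, inner_add_left, inner_add_right, hA v w, hB v w]; ring
  smul_mem' := by
    intro c A hA v w
    simp only [LinearMap.smul_apply, real_inner_smul_left, real_inner_smul_right, hA v w]; ring

/-- The Lie algebra of the stabiliser `U(n) × 1` of `(φ, ζ)` in `SO(V)`: the skew-symmetric
endomorphisms that commute with `φ` and annihilate `ζ`. -/
def unitary (φ : Module.End ℝ V) (ζ : V) : Submodule ℝ (Module.End ℝ V) where
  carrier := {A | A ∈ so V ∧ A * φ = φ * A ∧ A ζ = 0}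
  zero_mem' := by simp
  add_mem' := by
    rintro A B ⟨hA, hA', hA''⟩ ⟨hB, hB', hB''⟩
    exact ⟨add_mem hA hB, by rw [add_mul, mul_add, hA', hB'], by simp [hA'', hB'']⟩
  smul_mem' := by
    rintro c A ⟨hA, hA', hA''⟩
    exact ⟨Submodule.smul_mem _ c hA, by rw [smul_mul_assoc, mul_smul_comm, hA'], by simp [hA'']⟩

/-- The orthogonal complement of `unitary φ ζ` in `so V` with respect to the trace form
`(A, C) ↦ tr (A C)`, of which the Killing form of `so V` is a multiple. -/
def unitaryPerp (φ : Module.End ℝ V) (ζ : V) : Submodule ℝ (Module.End ℝ V) where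
  carrier := {A | A ∈ so V ∧ ∀ C ∈ unitary φ ζ, LinearMap.trace ℝ V (A * C) = 0}
  zero_mem' := by simp
  add_mem' := by
    rintro A B ⟨hA, hA'⟩ ⟨hB, hB'⟩
    exact ⟨add_mem hA hB, fun C hC => by rw [add_mul, map_add, hA' C hC, hB' C hC, add_zero]⟩
  smul_mem' := by
    rintro c A ⟨hA, hA'⟩
    exact ⟨Submodule.smul_mem _ c hA, fun C hC => by
      rw [smul_mul_assoc, map_smul, hA' C hC, smul_zero]⟩

open Classical in
/-- The component in `unitaryPerp φ ζ` of a skew-symmetric endomorphism `A` in the decomposition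
`so V = unitary φ ζ ⊕ unitaryPerp φ ζ`. -/
def perpPart (φ : Module.End ℝ V) (ζ : V) (A : Module.End ℝ V) : Module.End ℝ V :=
  if h : ∃ B ∈ unitaryPerp φ ζ, A - B ∈ unitary φ ζ then h.choose else 0

/-- `A ↦ ½ (A + φAφ + g(ζ, A·)ζ + g(ζ, ·)Aζ)` realises the decomposition of `so V`. -/
theorem exists_perpPart [FiniteDimensional ℝ V] {φ : Module.End ℝ V} {ζ : V} (hζ : ⟪ζ, ζ⟫_ℝ = 1)
    (hsq : ∀ v, φ (φ v) = -v + ⟪ζ, v⟫_ℝ • ζ) (hφ : φ ∈ so V) (hφζ : φ ζ = 0)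
    {A : Module.End ℝ V} (hA : A ∈ so V) :
    ∃! B, B ∈ unitaryPerp φ ζ ∧ A - B ∈ unitary φ ζ := by
  have sk : ∀ v w, ⟪A v, w⟫_ℝ = -⟪v, A w⟫_ℝ := hA
  have skφ : ∀ v w, ⟪φ v, w⟫_ℝ = -⟪v, φ w⟫_ℝ := hφ
  have Aζζ : ⟪ζ, A ζ⟫_ℝ = 0 := by
    have := sk ζ ζ
    rw [real_inner_comm] at this
    linarith
  have ηφ : ∀ v, ⟪ζ, φ v⟫_ℝ = 0 := fun v => by
    have := skφ ζ v
    rw [hφζ, inner_zero_left] at this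
    linarith
  let L : V →ₗ[ℝ] ℝ := (innerSL ℝ ζ).toLinearMap
  have hL : ∀ v, L v = ⟪ζ, v⟫_ℝ := fun v => rfl
  let B : Module.End ℝ V :=
    (1 / 2 : ℝ) • (A + φ * A * φ + (L ∘ₗ A).smulRight ζ + L.smulRight (A ζ))
  have hB : ∀ v, B v = (1 / 2 : ℝ) • (A v + φ (A (φ v)) + ⟪ζ, A v⟫_ℝ • ζ + ⟪ζ, v⟫_ℝ • A ζ) :=
    fun v => rfl
  have Bso : B ∈ so V := by
    intro v w
    have h1 := sk v w
    have h2 : ⟪φ (A (φ v)), w⟫_ℝ = -⟪v, φ (A (φ w))⟫_ℝ := by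
      rw [skφ, sk, ← neg_eq_iff_eq_neg.mpr (skφ v (A (φ w)))]
    have h3 := sk ζ v
    have h4 := sk ζ w
    have h5 := real_inner_comm ζ v
    have h6 := real_inner_comm ζ w
    have h7 := real_inner_comm (A ζ) v
    rw [hB, hB]
    simp only [real_inner_smul_left, real_inner_smul_right, inner_add_left, inner_add_right, h1, h2]
    linear_combination (1 / 2 : ℝ) * ⟪ζ, v⟫_ℝ * h4 + (1 / 2 : ℝ) * ⟪ζ, w⟫_ℝ * h3
      + (1 / 2 : ℝ) * ⟪ζ, A w⟫_ℝ * h5 + (1 / 2 : ℝ) * ⟪ζ, w⟫_ℝ * h7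
  have trace_zero : ∀ C ∈ unitary φ ζ, LinearMap.trace ℝ V (B * C) = 0 := by
    rintro C ⟨hC, hCφ, hCζ⟩
    have hCφ' : ∀ v, C (φ v) = φ (C v) := fun v => LinearMap.congr_fun hCφ v
    have e0 : L ∘ₗ C = 0 := by
      ext v
      have := hC ζ v
      rw [hCζ, inner_zero_left] at this
      simp only [LinearMap.comp_apply, hL, LinearMap.zero_apply]; linarith
    have e1 : LinearMap.trace ℝ V (φ * A * φ * C) = -LinearMap.trace ℝ V (A * C) := by
      have : φ * A * φ * C = φ * (A * (φ * C)) := by simp only [mul_assoc]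
      rw [this, LinearMap.trace_mul_comm]
      have : A * (φ * C) * φ = -(A * C) + (L.smulRight (A (C ζ))) := by
        ext v
        simp only [Module.End.mul_apply, hCφ', hsq, LinearMap.add_apply, LinearMap.neg_apply,
          LinearMap.smulRight_apply, hL, map_add, map_neg, map_smul]
        have : ⟪ζ, C v⟫_ℝ = 0 := LinearMap.congr_fun e0 v
        simp [this, hCζ]
      rw [this]; simp [hCζ]
    have e2 : ((L ∘ₗ A).smulRight ζ) * C = (L ∘ₗ A ∘ₗ C).smulRight ζ := rfl
    have e3 : (L.smulRight (A ζ)) * C = (L ∘ₗ C).smulRight (A ζ) := rfl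
    have e4 : LinearMap.trace ℝ V (((L ∘ₗ A).smulRight ζ) * C) = 0 := by
      rw [e2, LinearMap.trace_smulRight]; simp [hCζ]
    simp only [B, smul_mul_assoc, add_mul, map_smul, map_add, e1, e3, e4, e0]
    simp
  refine ⟨B, ⟨⟨Bso, trace_zero⟩, sub_mem hA Bso, ?_, ?_⟩, ?_⟩
  · ext v
    simp only [Module.End.mul_apply, LinearMap.sub_apply, hB, map_sub, map_smul, map_add, hsq, hφζ,
      ηφ, map_neg]
    module
  · simp only [LinearMap.sub_apply, hB, hφζ, map_zero, Aζζ, hζ]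
    module
  · rintro B' ⟨⟨hB's, hB't⟩, hB'u⟩
    have hu : B' - B ∈ unitary φ ζ := by
      have : A - B ∈ unitary φ ζ := by
        refine ⟨sub_mem hA Bso, ?_, ?_⟩
        · ext v
          simp only [Module.End.mul_apply, LinearMap.sub_apply, hB, map_sub, map_smul, map_add, hsq,
            hφζ, ηφ, map_neg]
          module
        · simp only [LinearMap.sub_apply, hB, hφζ, map_zero, Aζζ, hζ]
          module
      simpa using sub_mem this hB'u
    have ht : LinearMap.trace ℝ V ((B' - B) * (B' - B)) = 0 := by
      rw [sub_mul, map_sub, hB't _ hu, trace_zero _ hu, sub_zero]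
    rw [LinearMap.trace_eq_sum_inner _ (stdOrthonormalBasis ℝ V)] at ht
    have hz : ∑ i, ⟪(B' - B) (stdOrthonormalBasis ℝ V i), (B' - B) (stdOrthonormalBasis ℝ V i)⟫_ℝ
        = 0 := by
      rw [← neg_eq_zero, ← Finset.sum_neg_distrib, ← ht]
      refine Finset.sum_congr rfl fun i _ => ?_
      rw [hu.1 _ _, neg_neg, Module.End.mul_apply]
    have hz' := (Finset.sum_eq_zero_iff_of_nonneg fun i _ => real_inner_self_nonneg).1 hz
    refine sub_eq_zero.1 ((stdOrthonormalBasis ℝ V).toBasis.ext fun i => ?_)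
    simpa using hz' i (Finset.mem_univ _)

end LinearAlgebra

/-! ### Almost contact metric structures and the connections involved -/

section Geometry

variable {E : Type*} [NormedAddCommGroup E] [NormedSpace ℝ E] [FiniteDimensional ℝ E]
  {H : Type*} [TopologicalSpace H] (I : ModelWithCorners ℝ E H)
  (M : Type*) [TopologicalSpace M] [ChartedSpace H M] [IsManifold I ∞ M]
  [RiemannianBundle (fun x : M => TangentSpace I x)]

instance instFiniteDimensionalTangent (x : M) : FiniteDimensional ℝ (TangentSpace I x) :=
  inferInstanceAs (FiniteDimensional ℝ E)

/-- An almost contact metric structure `(φ, η, ζ)` on a Riemannian manifold `M`. -/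
structure AlmostContactMetric where
  /-- the endomorphism field -/
  φ (x : M) : TangentSpace I x →L[ℝ] TangentSpace I x
  /-- the one-form -/
  η (x : M) : TangentSpace I x →L[ℝ] ℝ
  /-- the unit vector field dual to the one-form -/
  ζ (x : M) : TangentSpace I x
  smooth_φ : ContMDiff I (I.prod 𝓘(ℝ, E →L[ℝ] E)) ∞
    (fun x => TotalSpace.mk' (E →L[ℝ] E) (E := fun x : M => TangentSpace I x →L[ℝ] TangentSpace I x)
      x (φ x))
  smooth_η : ContMDiff I (I.prod 𝓘(ℝ, E →L[ℝ] ℝ)) ∞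
    (fun x => TotalSpace.mk' (E →L[ℝ] ℝ) (E := fun x : M => TangentSpace I x →L[ℝ] Trivial M ℝ x)
      x (η x))
  smooth_ζ : ContMDiff I (I.prod 𝓘(ℝ, E)) ∞
    (fun x => TotalSpace.mk' E (E := fun x : M => TangentSpace I x) x (ζ x))
  dual (x : M) (v : TangentSpace I x) : η x v = ⟪ζ x, v⟫_ℝ
  norm_ζ (x : M) : ‖ζ x‖ = 1
  φ_sq (x : M) (v : TangentSpace I x) : φ x (φ x v) = -v + η x v • ζ x
  φ_inner (x : M) (v w : TangentSpace I x) : ⟪φ x v, φ x w⟫_ℝ = ⟪v, w⟫_ℝ - η x v * η x w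

variable {I M} [IsContMDiffRiemannianBundle I ∞ E (fun x : M => TangentSpace I x)]
  (D DG : CovariantDerivative I E (fun x : M => TangentSpace I x)) (S : AlmostContactMetric I M)

/-- `D` is compatible with the Riemannian metric of `M`. -/
def IsMetric : Prop :=
  CovariantDerivative.IsMetricCompatible (V := fun x : M => TangentSpace I x) (cov := (by exact D))

/-- `D` is the Levi-Civita connection of the metric of `M`. -/
structure IsLeviCivita : Prop where
  smooth : D.ContMDiffCovariantDerivative ∞
  torsion_eq_zero : D.torsion = 0
  metric : IsMetric D

/-- The difference `ξ_v w = D^G_v w - D_v w` of two connections, as an endomorphism in `w`. -/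
def torsionEnd (x : M) (v : TangentSpace I x) : Module.End ℝ (TangentSpace I x) :=
  ((DG.difference D x).flip v : TangentSpace I x →L[ℝ] TangentSpace I x).toLinearMap

/-- `DG` is a connection `∇^G`, `G = U(n) × 1`, whose connection form on the reduction of the
frame bundle defined by `S` is the `u(n)`-component of the connection form of `D`. That is, `DG` is
a `G`-connection (the metric, `φ` and `ζ` are parallel), and the connection forms of `DG` and `D`
differ by a form with values in the complement of `u(n)`. -/
structure IsGComponent : Prop where
  metric : IsMetric DG
  parallel_φ : ∀ (x : M) (Y : Π y : M, TangentSpace I y),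
    MDifferentiableAt I (I.prod 𝓘(ℝ, E))
      (fun y => TotalSpace.mk' E (E := fun x : M => TangentSpace I x) y (Y y)) x →
    ∀ v : TangentSpace I x, DG (fun y => S.φ y (Y y)) x v = S.φ x (DG Y x v)
  parallel_ζ : ∀ x : M, DG S.ζ x = 0
  perp : ∀ (x : M) (v : TangentSpace I x),
    torsionEnd D DG x v ∈ unitaryPerp (S.φ x : TangentSpace I x →ₗ[ℝ] TangentSpace I x) (S.ζ x)

/-! ### Existence of the `G`-component of a metric connection -/

section Existence

theorem mdiff_φ {x : M} {Y : Π y : M, TangentSpace I y} (hY : MDiffAt (T% Y) x) :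
    MDiffAt (T% (fun y => S.φ y (Y y))) x :=
  MDifferentiableAt.clm_bundle_apply (F₁ := E) (F₂ := E)
    ((S.smooth_φ x).mdifferentiableAt (by simp)) hY

theorem mdiff_ζ (x : M) : MDiffAt (T% S.ζ) x := (S.smooth_ζ x).mdifferentiableAt (by simp)

variable {D}

theorem inner_rule (hD : IsMetric D)
    {x : M} {Y Z : Π y : M, TangentSpace I y} (hY : MDiffAt (T% Y) x) (hZ : MDiffAt (T% Z) x)
    (v : TangentSpace I x) :
    mvfderiv I (fun y => ⟪Y y, Z y⟫_ℝ) x v = ⟪D Y x v, Z x⟫_ℝ + ⟪Y x, D Z x v⟫_ℝ := by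
  have := CovariantDerivative.IsMetricCompatible.mvfderiv_inner_eq hD (FiberBundle.extend E v)
    hY hZ
  simpa using this

theorem isMetric_of_rule (D : CovariantDerivative I E (fun x : M => TangentSpace I x))
    (h : ∀ (x : M) (Y Z : Π y : M, TangentSpace I y), MDiffAt (T% Y) x → MDiffAt (T% Z) x →
      ∀ v : TangentSpace I x,
        mvfderiv I (fun y => ⟪Y y, Z y⟫_ℝ) x v = ⟪D Y x v, Z x⟫_ℝ + ⟪Y x, D Z x v⟫_ℝ) :
    IsMetric D := by
  unfold IsMetric
  rw [CovariantDerivative.isMetricCompatible_iff]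
  intro x X Y Z _ hY hZ
  exact h x Y Z hY hZ (X x)

theorem tensorial_dφ (x : M) : TensorialAt I E (fun Y : Π y : M, TangentSpace I y =>
    D (fun y => S.φ y (Y y)) x - (S.φ x) ∘L (D Y x)) x where
  smul {f Y} hf hY := by
    have h1 := D.isCovariantDerivativeOnUniv.leibniz (mdiff_φ S hY) hf
    have h2 := D.isCovariantDerivativeOnUniv.leibniz hY hf
    have h3 : (fun y => S.φ y ((f • Y) y)) = f • fun y => S.φ y (Y y) := by
      ext y; simp
    rw [h3]
    ext v
    simp [h1, h2]
    module
  add {Y Z} hY hZ := by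
    have h1 := D.isCovariantDerivativeOnUniv.add (mdiff_φ S hY) (mdiff_φ S hZ)
    have h2 := D.isCovariantDerivativeOnUniv.add hY hZ
    have h3 : (fun y => S.φ y ((Y + Z) y)) = (fun y => S.φ y (Y y)) + fun y => S.φ y (Z y) := by
      ext y; simp
    rw [h3]
    ext v
    simp [h1, h2]
    module

theorem inner_ζ_self (x : M) : ⟪S.ζ x, S.ζ x⟫_ℝ = 1 := by
  rw [real_inner_self_eq_norm_sq, S.norm_ζ, one_pow]

theorem φ_ζ (x : M) : S.φ x (S.ζ x) = 0 := by
  have := S.φ_inner x (S.ζ x) (S.ζ x)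
  rw [S.dual, inner_ζ_self] at this
  exact inner_self_eq_zero.1 (this.trans (by norm_num))

theorem inner_ζ_φ (x : M) (v : TangentSpace I x) : ⟪S.ζ x, S.φ x v⟫_ℝ = 0 := by
  have h1 := S.φ_sq x (S.φ x v)
  rw [S.φ_sq x v, map_add, map_neg, map_smul, φ_ζ, smul_zero, add_zero, S.dual] at h1
  have h2 : ⟪S.ζ x, S.φ x v⟫_ℝ • S.ζ x = 0 := by
    simpa using h1.symm
  have h3 := congrArg (fun w => ⟪S.ζ x, w⟫_ℝ) h2
  simpa [real_inner_smul_right, S.norm_ζ] using h3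

theorem φ_skew (x : M) (v w : TangentSpace I x) : ⟪S.φ x v, w⟫_ℝ = -⟪v, S.φ x w⟫_ℝ := by
  have h := S.φ_inner x v (S.φ x w)
  rw [S.φ_sq, S.dual, S.dual, S.dual, inner_ζ_φ, inner_add_right, inner_neg_right,
    real_inner_smul_right, real_inner_comm (S.ζ x), inner_ζ_φ] at h
  linarith

variable (D) in
/-- `w ↦ (v ↦ (D_v φ) w)`. -/
def dφ (x : M) : TangentSpace I x →L[ℝ] TangentSpace I x →L[ℝ] TangentSpace I x :=
  TensorialAt.mkHom _ x (tensorial_dφ (D := D) S x)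

theorem dφ_apply {x : M} {Y : Π y : M, TangentSpace I y} (hY : MDiffAt (T% Y) x)
    (v : TangentSpace I x) :
    dφ D S x (Y x) v = D (fun y => S.φ y (Y y)) x v - S.φ x (D Y x v) := by
  rw [dφ, TensorialAt.mkHom_apply _ hY]; rfl

theorem inner_dζ_ζ (hD : IsMetric D) (x : M) (v : TangentSpace I x) : ⟪S.ζ x, D S.ζ x v⟫_ℝ = 0 := by
  have h := inner_rule hD (mdiff_ζ S x) (mdiff_ζ S x) v
  have h1 : (fun y => ⟪S.ζ y, S.ζ y⟫_ℝ) = fun _ => (1 : ℝ) := funext (inner_ζ_self S)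
  rw [h1, mvfderiv_const, real_inner_comm] at h
  simp at h
  linarith

theorem dφ_skew (hD : IsMetric D) (x : M) (v w u : TangentSpace I x) :
    ⟪dφ D S x w v, u⟫_ℝ = -⟪w, dφ D S x u v⟫_ℝ := by
  have hw := FiberBundle.extend_apply_self E w
  have hu := FiberBundle.extend_apply_self E u
  have mw := FiberBundle.mdifferentiableAt_extend I E w
  have mu := FiberBundle.mdifferentiableAt_extend I E u
  set W := FiberBundle.extend E w
  set U := FiberBundle.extend E u
  have h1 := inner_rule hD (mdiff_φ S mw) mu v
  have h2 := inner_rule hD mw (mdiff_φ S mu) v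
  have h3 : (fun y => ⟪S.φ y (W y), U y⟫_ℝ) = -fun y => ⟪W y, S.φ y (U y)⟫_ℝ :=
    funext fun y => φ_skew S y _ _
  rw [h3, mvfderiv_neg] at h1
  have h4 := dφ_apply (D := D) S mw v
  have h5 := dφ_apply (D := D) S mu v
  have h6 := φ_skew S x (D W x v) u
  have h7 := φ_skew S x w (D U x v)
  rw [hw, hu] at h1 h2
  rw [hw] at h4
  rw [hu] at h5
  rw [h4, h5, inner_sub_left, inner_sub_right]
  simp only [neg_apply] at h1
  linarith

theorem φ_dφ (hD : IsMetric D) (x : M) (v w : TangentSpace I x) :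
    S.φ x (dφ D S x w v) + dφ D S x (S.φ x w) v =
      ⟪D S.ζ x v, w⟫_ℝ • S.ζ x + ⟪S.ζ x, w⟫_ℝ • D S.ζ x v := by
  have hw := FiberBundle.extend_apply_self E w
  have mw := FiberBundle.mdifferentiableAt_extend I E w
  set W := FiberBundle.extend E w
  have h1 := dφ_apply (D := D) S mw v
  have h2 := dφ_apply (D := D) S (mdiff_φ S mw) v
  have h3 := inner_rule hD (mdiff_ζ S x) mw v
  have mη : MDiffAt (fun y => ⟪S.ζ y, W y⟫_ℝ) x :=
    MDifferentiableAt.inner_bundle (mdiff_ζ S x) mw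
  have h4 := D.isCovariantDerivativeOnUniv.leibniz (mdiff_ζ S x) mη
  have h5 := D.isCovariantDerivativeOnUniv.leibniz (g := fun _ : M => (-1 : ℝ)) mw
    mdifferentiableAt_const
  have h6 : (fun y => S.φ y (S.φ y (W y))) =
      (fun _ : M => (-1 : ℝ)) • W + (fun y => ⟪S.ζ y, W y⟫_ℝ) • S.ζ := by
    funext y
    simp [S.φ_sq, S.dual]
  have h7 := D.isCovariantDerivativeOnUniv.add
    (mdifferentiableAt_const (c := (-1 : ℝ)) |>.smul_section mw) (mη.smul_section (mdiff_ζ S x))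
  rw [h6, h7, h4, h5] at h2
  rw [hw] at h1 h2 h3
  rw [h2, h1]
  simp only [add_apply, smul_apply,
    ContinuousLinearMap.smulRight_apply, mvfderiv_const, h3, map_sub, S.φ_sq, S.dual,
    zero_apply]
  module

theorem dφ_ζ (x : M) (v : TangentSpace I x) : dφ D S x (S.ζ x) v = -S.φ x (D S.ζ x v) := by
  rw [dφ_apply S (mdiff_ζ S x)]
  have : (fun y => S.φ y (S.ζ y)) = 0 := funext (φ_ζ S)
  rw [this, D.zero]
  simp

variable (D) in
/-- `w ↦ (v ↦ ½ (D_v φ)(φ w) + ½ g(D_v ζ, w) ζ - η(w) D_v ζ)`. -/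
def correction (x : M) : TangentSpace I x →L[ℝ] TangentSpace I x →L[ℝ] TangentSpace I x :=
  LinearMap.toContinuousLinearMap
    { toFun := fun w => (1 / 2 : ℝ) • dφ D S x (S.φ x w)
        + (1 / 2 : ℝ) • (innerSL ℝ w ∘L D S.ζ x).smulRight (S.ζ x) - ⟪S.ζ x, w⟫_ℝ • D S.ζ x
      map_add' := by
        intro w w'
        ext v
        simp [inner_add_right]
        module
      map_smul' := by
        intro c w
        ext v
        simp [real_inner_smul_right]
        module }

theorem correction_apply (x : M) (w v : TangentSpace I x) :
    correction D S x w v = (1 / 2 : ℝ) • dφ D S x (S.φ x w) v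
      + (1 / 2 : ℝ) • ⟪w, D S.ζ x v⟫_ℝ • S.ζ x - ⟪S.ζ x, w⟫_ℝ • D S.ζ x v := rfl

theorem torsionEnd_addOneForm
    (A : Π x : M, TangentSpace I x →L[ℝ] TangentSpace I x →L[ℝ] TangentSpace I x) (x : M)
    (v w : TangentSpace I x) : torsionEnd D (D.addOneForm A) x v w = A x w v := by
  have h := IsCovariantDerivativeOn.difference_apply (I := I) (F := E) (x := x)
    (D.addOneForm A).isCovariantDerivativeOnUniv D.isCovariantDerivativeOnUniv trivial
    (FiberBundle.mdifferentiableAt_extend I E w)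
  rw [FiberBundle.extend_apply_self] at h
  have h2 := congrArg (fun B : TangentSpace I x →L[ℝ] TangentSpace I x => B v) h
  refine h2.trans ?_
  simp [CovariantDerivative.addOneForm]

theorem correction_skew (hD : IsMetric D) (x : M) (v w u : TangentSpace I x) :
    ⟪correction D S x w v, u⟫_ℝ = -⟪w, correction D S x u v⟫_ℝ := by
  have h1 := dφ_skew S hD x v (S.φ x w) u
  have h2 := φ_skew S x w (dφ D S x u v)
  have h3 := congrArg (fun z => ⟪w, z⟫_ℝ) (φ_dφ S hD x v u)
  simp only [inner_add_right, real_inner_smul_right] at h3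
  simp only [correction_apply, inner_add_left, inner_sub_left, inner_add_right, inner_sub_right,
    real_inner_smul_left, real_inner_smul_right]
  have h4 := real_inner_comm (S.ζ x) w
  have h5 := real_inner_comm (D S.ζ x v) w
  have h6 := real_inner_comm (D S.ζ x v) u
  rw [h4, h5] at h3
  rw [h4, h5, h6]
  linarith

theorem correction_φ (hD : IsMetric D) (x : M) (v w : TangentSpace I x) :
    dφ D S x w v + correction D S x (S.φ x w) v = S.φ x (correction D S x w v) := by
  have h1 := φ_dφ S hD x v (S.φ x w)
  rw [inner_ζ_φ, zero_smul, add_zero, S.φ_sq, S.dual] at h1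
  simp only [map_add, map_neg, map_smul, add_apply,
    neg_apply, smul_apply, dφ_ζ] at h1
  simp only [correction_apply, inner_ζ_φ, S.φ_sq, S.dual, map_add, map_sub, map_neg, map_smul,
    φ_ζ, add_apply, neg_apply,
    smul_apply, dφ_ζ]
  rw [eq_sub_of_add_eq h1, real_inner_comm (S.φ x w)]
  module

theorem correction_perp (hD : IsMetric D) (x : M) (v : TangentSpace I x) :
    ((correction D S x).flip v : TangentSpace I x →L[ℝ] TangentSpace I x).toLinearMap ∈
      unitaryPerp (S.φ x : TangentSpace I x →ₗ[ℝ] TangentSpace I x) (S.ζ x) := by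
  refine ⟨fun w u => correction_skew S hD x v w u, ?_⟩
  rintro C ⟨hC, hCφ, hCζ⟩
  let φ' : Module.End ℝ (TangentSpace I x) := (S.φ x).toLinearMap
  let P : Module.End ℝ (TangentSpace I x) :=
    ((dφ D S x).flip v : TangentSpace I x →L[ℝ] TangentSpace I x).toLinearMap
  let Lζ : TangentSpace I x →ₗ[ℝ] ℝ := (innerSL ℝ (S.ζ x)).toLinearMap
  let LZ : TangentSpace I x →ₗ[ℝ] ℝ := (innerSL ℝ (D S.ζ x v)).toLinearMap
  have hCφ' : C * φ' = φ' * C := hCφ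
  have hc : φ' * P + P * φ' = LZ.smulRight (S.ζ x) + Lζ.smulRight (D S.ζ x v) := by
    ext w
    exact φ_dφ S hD x v w
  have hξ : ((correction D S x).flip v : TangentSpace I x →L[ℝ] TangentSpace I x).toLinearMap =
      (1 / 2 : ℝ) • (P * φ') + (1 / 2 : ℝ) • LZ.smulRight (S.ζ x)
        - Lζ.smulRight (D S.ζ x v) := by
    ext w
    change correction D S x w v = _
    rw [correction_apply, real_inner_comm]
    rfl
  have e1 : LinearMap.trace ℝ _ (LZ.smulRight (S.ζ x) * C) = 0 := by
    rw [LinearMap.trace_mul_comm]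
    have : C * LZ.smulRight (S.ζ x) = 0 := by
      ext w; simp [hCζ]
    rw [this, map_zero]
  have e2 : LinearMap.trace ℝ _ (Lζ.smulRight (D S.ζ x v) * C) = 0 := by
    have : Lζ.smulRight (D S.ζ x v) * C = 0 := by
      ext w
      have h := hC (S.ζ x) w
      rw [hCζ, inner_zero_left] at h
      have h' : Lζ (C w) = 0 := by
        change ⟪S.ζ x, C w⟫_ℝ = 0
        linarith
      simp [h']
    rw [this, map_zero]
  have e3 : LinearMap.trace ℝ _ (φ' * P * C) = LinearMap.trace ℝ _ (P * φ' * C) := by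
    rw [mul_assoc, LinearMap.trace_mul_comm, mul_assoc, hCφ', mul_assoc]
  have e4 := congrArg (fun B => LinearMap.trace ℝ _ (B * C)) hc
  simp only [add_mul, map_add, e1, e2, e3] at e4
  rw [hξ, sub_mul, add_mul, smul_mul_assoc, smul_mul_assoc, map_sub, map_add, map_smul, map_smul,
    e1, e2, smul_zero, add_zero, sub_zero]
  have : LinearMap.trace ℝ _ (P * φ' * C) = 0 := by linarith
  rw [this, smul_zero]

theorem exists_isGComponent (hD : IsMetric D) : ∃ DG, IsGComponent D DG S := by
  have key : ∀ (x : M) (Y : Π y : M, TangentSpace I y) (v : TangentSpace I x),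
      (D.addOneForm (correction D S)) Y x v = D Y x v + correction D S x (Y x) v := fun _ _ _ => rfl
  refine ⟨D.addOneForm (correction D S), ?_, ?_, ?_, ?_⟩
  · refine isMetric_of_rule _ fun x Y Z hY hZ v => ?_
    have h := inner_rule hD hY hZ v
    have h2 := correction_skew S hD x v (Y x) (Z x)
    refine h.trans ?_
    rw [key, key, inner_add_left, inner_add_right]
    linarith
  · intro x Y hY v
    rw [key, key, map_add, ← correction_φ S hD, dφ_apply S hY]
    abel
  · intro x
    ext v
    rw [key, correction_apply, φ_ζ, map_zero, inner_dζ_ζ S hD, inner_ζ_self]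
    simp
  · intro x v
    have : torsionEnd D (D.addOneForm (correction D S)) x v =
        ((correction D S x).flip v : TangentSpace I x →L[ℝ] TangentSpace I x).toLinearMap := by
      ext w
      exact torsionEnd_addOneForm _ x v w
    rw [this]
    exact correction_perp S hD x v

/-- The connection `∇^G` of the `U(n) × 1`-structure `S`, obtained from the `u(n)`-component of the
connection form of the Levi-Civita connection `D`. Its values on differentiable vector fields are
uniquely determined by `IsGComponent`. -/
def gConnection (hD : IsLeviCivita D) : CovariantDerivative I E (fun x : M => TangentSpace I x) :=
  (exists_isGComponent S hD.metric).choose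

theorem gConnection_spec (hD : IsLeviCivita D) : IsGComponent D (gConnection S hD) S :=
  (exists_isGComponent S hD.metric).choose_spec

/-- The intrinsic torsion `ξ_v w = ∇^G_v w - ∇_v w`, as an endomorphism in `w`. -/
def intrinsicTorsion (hD : IsLeviCivita D) (x : M) (v : TangentSpace I x) :
    Module.End ℝ (TangentSpace I x) :=
  torsionEnd D (gConnection S hD) x v

end Existence

/-- `R(X, Y)Z = ∇_X ∇_Y Z - ∇_Y ∇_X Z - ∇_[X,Y] Z` for vector fields `X`, `Y`, `Z`. -/
def curvatureField (X Y Z : Π x : M, TangentSpace I x) (x : M) : TangentSpace I x :=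
  D (fun y => D Z y (Y y)) x (X x) - D (fun y => D Z y (X y)) x (Y x)
    - D Z x (VectorField.mlieBracket I X Y x)

variable (I) in
/-- A fixed orthonormal basis of `T_x M`. All sums over it below are traces of multilinear
expressions and do not depend on the choice of the basis. -/
def frame (x : M) : OrthonormalBasis (Fin (Module.finrank ℝ (TangentSpace I x))) ℝ
    (TangentSpace I x) :=
  stdOrthonormalBasis ℝ (TangentSpace I x)

/-- The curvature tensor as an endomorphism `w ↦ R(u, v)w` of `T_x M`. Tangent vectors are extended
to vector fields that are smooth near `x`, and `R(u, v)` is the linear map with the resulting values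
on a basis. -/
def curvature (x : M) (u v : TangentSpace I x) : Module.End ℝ (TangentSpace I x) :=
  (frame I x).toBasis.constr ℝ fun i =>
    curvatureField D (FiberBundle.extend E u) (FiberBundle.extend E v)
      (FiberBundle.extend E (frame I x i)) x

/-- `Ric(u, v) = ∑ᵢ g(R(u, eᵢ)eᵢ, v)`. -/
def ricci (x : M) (u v : TangentSpace I x) : ℝ :=
  ∑ i, ⟪curvature D x u (frame I x i) (frame I x i), v⟫_ℝ

/-- The scalar curvature `s = ∑ᵢ Ric(eᵢ, eᵢ)`. -/
def scalarCurvature (x : M) : ℝ := ∑ i, ricci D x (frame I x i) (frame I x i)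

/-- The `*`-scalar curvature `s* = ∑ᵢⱼ g(R(eᵢ, eⱼ)φeⱼ, φeᵢ)`. -/
def starScalarCurvature (x : M) : ℝ :=
  ∑ i, ∑ j, ⟪curvature D x (frame I x i) (frame I x j) (S.φ x (frame I x j)),
    S.φ x (frame I x i)⟫_ℝ

/-- The `u(n)^⊥`-component of a skew-symmetric endomorphism of `T_x M`. -/
def AlmostContactMetric.perp (x : M) (A : Module.End ℝ (TangentSpace I x)) :
    Module.End ℝ (TangentSpace I x) :=
  perpPart (S.φ x : TangentSpace I x →ₗ[ℝ] TangentSpace I x) (S.ζ x) A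

/-- `s_{u(n)^⊥} = ∑ᵢⱼ g(R(eᵢ, eⱼ)_{u(n)^⊥} eⱼ, eᵢ)`. -/
def sPerp (x : M) : ℝ :=
  ∑ i, ∑ j, ⟪S.perp x (curvature D x (frame I x i) (frame I x j)) (frame I x j), frame I x i⟫_ℝ

variable {D} (hD : IsLeviCivita D)

/-- `s^alt_{u(n)^⊥} = ∑ᵢⱼ g([ξ_{eᵢ}, ξ_{eⱼ}]_{u(n)^⊥} eⱼ, eᵢ)`. -/
def sAltPerp (x : M) : ℝ :=
  ∑ i, ∑ j, ⟪S.perp x ⁅intrinsicTorsion S hD x (frame I x i), intrinsicTorsion S hD x (frame I x j)⁆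
    (frame I x j), frame I x i⟫_ℝ

/-- `α(u, v, w) = g(ξ_u v, w)`. -/
def alpha (x : M) (u v w : TangentSpace I x) : ℝ := ⟪intrinsicTorsion S hD x u v, w⟫_ℝ

/-! The quadratic invariants, for a family `e` of `m` tangent vectors at `x` (an orthonormal basis
of `ker η`). -/

variable {m : ℕ} (x : M) (e : Fin m → TangentSpace I x)

def i7 : ℝ := ∑ j, ∑ k, alpha S hD x (S.ζ x) (e j) (e k) * alpha S hD x (e j) (S.ζ x) (e k)

def i8 : ℝ := ∑ i, ∑ j, alpha S hD x (e i) (e j) (S.ζ x) * alpha S hD x (e j) (e i) (S.ζ x)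

def i10 : ℝ := ∑ i, ∑ j, alpha S hD x (e i) (e i) (S.ζ x) * alpha S hD x (e j) (e j) (S.ζ x)

def i12 : ℝ := ∑ i, ∑ j, alpha S hD x (e i) (e j) (S.ζ x) *
  alpha S hD x (S.φ x (e j)) (S.φ x (e i)) (S.ζ x)

def i14 : ℝ := ∑ i, ∑ j, alpha S hD x (e i) (S.φ x (e i)) (S.ζ x) *
  alpha S hD x (e j) (S.φ x (e j)) (S.ζ x)

def i17 : ℝ := ∑ i, ∑ k, alpha S hD x (e i) (e i) (e k) * alpha S hD x (S.ζ x) (S.ζ x) (e k)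

end Geometry

end AlmostContact

end

namespace AlmostContact

section AdaptedFrames

variable {V : Type*} [NormedAddCommGroup V] [InnerProductSpace ℝ V]

/-- The pointwise algebra of an almost contact metric structure. -/
structure IsAlmostContact (φ : Module.End ℝ V) (ζ : V) : Prop where
  inner_self : ⟪ζ, ζ⟫_ℝ = 1
  sq : ∀ v, φ (φ v) = -v + ⟪ζ, v⟫_ℝ • ζ
  skew : φ ∈ so V
  map_zeta : φ ζ = 0

/-- `A ↦ ½ (A + φAφ + g(ζ, A·)ζ + g(ζ, ·)Aζ)`. -/
noncomputable def perpFormula (φ : Module.End ℝ V) (ζ : V) (A : Module.End ℝ V) :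
    Module.End ℝ V :=
  (1 / 2 : ℝ) • (A + φ * A * φ + ((innerSL ℝ ζ).toLinearMap ∘ₗ A).smulRight ζ
    + (innerSL ℝ ζ).toLinearMap.smulRight (A ζ))

theorem perpFormula_apply (φ : Module.End ℝ V) (ζ : V) (A : Module.End ℝ V) (v : V) :
    perpFormula φ ζ A v =
      (1 / 2 : ℝ) • (A v + φ (A (φ v)) + ⟪ζ, A v⟫_ℝ • ζ + ⟪ζ, v⟫_ℝ • A ζ) := rfl

namespace IsAlmostContact

variable {φ : Module.End ℝ V} {ζ : V} (h : IsAlmostContact φ ζ)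
include h

theorem inner_map (v : V) : ⟪ζ, φ v⟫_ℝ = 0 := by
  have := h.skew ζ v
  rw [h.map_zeta, inner_zero_left] at this
  linarith

theorem inner_map_map (v w : V) : ⟪φ v, φ w⟫_ℝ = ⟪v, w⟫_ℝ - ⟪ζ, v⟫_ℝ * ⟪ζ, w⟫_ℝ := by
  rw [h.skew, h.sq, inner_add_right, inner_neg_right, real_inner_smul_right, real_inner_comm ζ v]
  ring

theorem perpFormula_mem_so {A : Module.End ℝ V} (hA : A ∈ so V) : perpFormula φ ζ A ∈ so V := by
  intro v w
  have h2 : ⟪φ (A (φ v)), w⟫_ℝ = -⟪v, φ (A (φ w))⟫_ℝ := by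
    rw [h.skew, hA, ← neg_eq_iff_eq_neg.mpr (h.skew v (A (φ w)))]
  have h3 := hA ζ v
  have h4 := hA ζ w
  have h5 := real_inner_comm ζ v
  have h7 := real_inner_comm (A ζ) v
  simp only [perpFormula_apply, real_inner_smul_left, real_inner_smul_right, inner_add_left,
    inner_add_right, hA v w, h2]
  linear_combination (1 / 2 : ℝ) * ⟪ζ, v⟫_ℝ * h4 + (1 / 2 : ℝ) * ⟪ζ, w⟫_ℝ * h3
    + (1 / 2 : ℝ) * ⟪ζ, A w⟫_ℝ * h5 + (1 / 2 : ℝ) * ⟪ζ, w⟫_ℝ * h7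

theorem sub_perpFormula_mem {A : Module.End ℝ V} (hA : A ∈ so V) :
    A - perpFormula φ ζ A ∈ unitary φ ζ := by
  have hz : ⟪ζ, A ζ⟫_ℝ = 0 := by
    have := hA ζ ζ
    rw [real_inner_comm] at this
    linarith
  refine ⟨sub_mem hA (h.perpFormula_mem_so hA), ?_, ?_⟩
  · ext v
    simp only [Module.End.mul_apply, LinearMap.sub_apply, perpFormula_apply, map_sub, map_smul,
      map_add, h.sq, h.map_zeta, h.inner_map, map_neg]
    module
  · simp only [LinearMap.sub_apply, perpFormula_apply, h.map_zeta, map_zero, hz, h.inner_self]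
    module

variable [FiniteDimensional ℝ V]

theorem perpFormula_mem {A : Module.End ℝ V} (hA : A ∈ so V) :
    perpFormula φ ζ A ∈ unitaryPerp φ ζ := by
  refine ⟨h.perpFormula_mem_so hA, ?_⟩
  rintro C ⟨hC, hCφ, hCζ⟩
  have hCφ' : ∀ v, C (φ v) = φ (C v) := fun v => LinearMap.congr_fun hCφ v
  let L : V →ₗ[ℝ] ℝ := (innerSL ℝ ζ).toLinearMap
  have hL : ∀ v, L v = ⟪ζ, v⟫_ℝ := fun v => rfl
  have e0 : L ∘ₗ C = 0 := by
    ext v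
    have := hC ζ v
    rw [hCζ, inner_zero_left] at this
    simp only [LinearMap.comp_apply, hL, LinearMap.zero_apply]
    linarith
  have e1 : LinearMap.trace ℝ V (φ * A * φ * C) = -LinearMap.trace ℝ V (A * C) := by
    have e : φ * A * φ * C = φ * (A * (φ * C)) := by simp only [mul_assoc]
    have e' : A * (φ * C) * φ = -(A * C) := by
      ext v
      have : ⟪ζ, C v⟫_ℝ = 0 := LinearMap.congr_fun e0 v
      simp [hCφ', h.sq, this]
    rw [e, LinearMap.trace_mul_comm, e', map_neg]
  have e2 : LinearMap.trace ℝ V ((L ∘ₗ A).smulRight ζ * C) = 0 := by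
    rw [show (L ∘ₗ A).smulRight ζ * C = (L ∘ₗ A ∘ₗ C).smulRight ζ from rfl,
      LinearMap.trace_smulRight]
    simp [hCζ]
  have e3 : L.smulRight (A ζ) * C = 0 := by
    rw [show L.smulRight (A ζ) * C = (L ∘ₗ C).smulRight (A ζ) from rfl, e0]
    simp
  change LinearMap.trace ℝ V (((1 / 2 : ℝ) • (A + φ * A * φ + (L ∘ₗ A).smulRight ζ
    + L.smulRight (A ζ))) * C) = 0
  rw [smul_mul_assoc, add_mul, add_mul, add_mul, e3]
  simp only [map_smul, map_add, e1, e2, map_zero]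
  simp

theorem perpPart_eq {A : Module.End ℝ V} (hA : A ∈ so V) :
    perpPart φ ζ A = perpFormula φ ζ A := by
  have hex := exists_perpPart h.inner_self h.sq h.skew h.map_zeta hA
  have hmem : ∃ B ∈ unitaryPerp φ ζ, A - B ∈ unitary φ ζ := hex.exists
  rw [perpPart, dif_pos hmem]
  exact hex.unique hmem.choose_spec ⟨h.perpFormula_mem hA, h.sub_perpFormula_mem hA⟩

theorem perpFormula_eq_self {B : Module.End ℝ V} (hB : B ∈ unitaryPerp φ ζ) :
    perpFormula φ ζ B = B :=
  (exists_perpPart h.inner_self h.sq h.skew h.map_zeta hB.1).unique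
    ⟨h.perpFormula_mem hB.1, h.sub_perpFormula_mem hB.1⟩ ⟨hB, by simp⟩

/-- An element of the complement of `u(n)` anticommutes with `φ` on `ker η`. -/
theorem inner_perp_map_map {B : Module.End ℝ V} (hB : B ∈ unitaryPerp φ ζ) (v w : V)
    (hv : ⟪ζ, v⟫_ℝ = 0) (hw : ⟪ζ, w⟫_ℝ = 0) : ⟪B (φ v), φ w⟫_ℝ = -⟪B v, w⟫_ℝ := by
  have e := congrArg (fun z => ⟪z, w⟫_ℝ) (LinearMap.congr_fun (h.perpFormula_eq_self hB) v)
  simp only [perpFormula_apply, inner_add_left, real_inner_smul_left, hv, hw] at e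
  have := h.skew (B (φ v)) w
  linarith

end IsAlmostContact

end AdaptedFrames

section FrameSums

variable {V : Type*} [NormedAddCommGroup V] [InnerProductSpace ℝ V]

theorem lie_mem_so {A B : Module.End ℝ V} (hA : A ∈ so V) (hB : B ∈ so V) : ⁅A, B⁆ ∈ so V := by
  intro v w
  simp only [Ring.lie_def, LinearMap.sub_apply, Module.End.mul_apply, inner_sub_left,
    inner_sub_right]
  rw [hA, hB, hB (A v), hA v]
  ring

theorem inner_self_of_mem_so {A : Module.End ℝ V} (hA : A ∈ so V) (v : V) : ⟪A v, v⟫_ℝ = 0 := by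
  have := hA v v
  rw [real_inner_comm v (A v)] at this
  linarith [real_inner_comm v (A v)]

theorem perpFormula_add (φ : Module.End ℝ V) (ζ : V) (A B : Module.End ℝ V) :
    perpFormula φ ζ (A + B) = perpFormula φ ζ A + perpFormula φ ζ B := by
  ext v
  simp only [perpFormula_apply, LinearMap.add_apply, map_add, inner_add_right]
  module

theorem perpFormula_smul (φ : Module.End ℝ V) (ζ : V) (c : ℝ) (A : Module.End ℝ V) :
    perpFormula φ ζ (c • A) = c • perpFormula φ ζ A := by
  ext v
  simp only [perpFormula_apply, LinearMap.smul_apply, map_smul, real_inner_smul_right]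
  module

variable {κ κ' : Type*} [Fintype κ] [Fintype κ']

/-- The trace of a bilinear map does not depend on the orthonormal basis. -/
theorem sum_bilin_eq (f : OrthonormalBasis κ ℝ V) (b : OrthonormalBasis κ' ℝ V)
    (B : V →ₗ[ℝ] V →ₗ[ℝ] ℝ) : ∑ a, B (f a) (f a) = ∑ a, B (b a) (b a) := by
  have : FiniteDimensional ℝ V := f.toBasis.finiteDimensional_of_finite
  have e := (InnerProductSpace.canonicalCovariantTensor_eq_sum V f).symm.trans
    (InnerProductSpace.canonicalCovariantTensor_eq_sum V b)
  simpa using congrArg (TensorProduct.lift B) e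

/-- The double trace of a 4-linear expression in a tensor `T` with values in endomorphisms does not
depend on the orthonormal basis. -/
theorem sum_perpFormula_eq (φ : Module.End ℝ V) (ζ : V) (T : V →ₗ[ℝ] V →ₗ[ℝ] Module.End ℝ V)
    (f : OrthonormalBasis κ ℝ V) (b : OrthonormalBasis κ' ℝ V) :
    ∑ i, ∑ j, ⟪perpFormula φ ζ (T (f i) (f j)) (f j), f i⟫_ℝ =
      ∑ i, ∑ j, ⟪perpFormula φ ζ (T (b i) (b j)) (b j), b i⟫_ℝ := by
  have e1 : ∀ u u' : V, ∑ j, ⟪perpFormula φ ζ (T u (f j)) (f j), u'⟫_ℝ =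
      ∑ j, ⟪perpFormula φ ζ (T u (b j)) (b j), u'⟫_ℝ := fun u u' =>
    sum_bilin_eq f b (LinearMap.mk₂ ℝ (fun v v' => ⟪perpFormula φ ζ (T u v) v', u'⟫_ℝ)
      (by simp [perpFormula_add, inner_add_left])
      (by simp [perpFormula_smul, real_inner_smul_left])
      (by simp [inner_add_left]) (by simp [real_inner_smul_left]))
  simp only [e1]
  exact sum_bilin_eq f b (LinearMap.mk₂ ℝ
    (fun u u' => ∑ j, ⟪perpFormula φ ζ (T u (b j)) (b j), u'⟫_ℝ)
      (by simp [perpFormula_add, inner_add_left, Finset.sum_add_distrib])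
      (by simp [perpFormula_smul, real_inner_smul_left, Finset.mul_sum])
      (by simp [inner_add_right, Finset.sum_add_distrib])
      (by simp [real_inner_smul_right, Finset.mul_sum]))

variable {ι : Type*} [Fintype ι]

theorem parseval_option {b : OrthonormalBasis (Option ι) ℝ V} {ζ : V} (hb : b none = ζ) (u v : V) :
    ⟪u, v⟫_ℝ = ⟪u, ζ⟫_ℝ * ⟪v, ζ⟫_ℝ + ∑ k, ⟪u, b (some k)⟫_ℝ * ⟪v, b (some k)⟫_ℝ := by
  rw [← b.sum_inner_mul_inner u v, Fintype.sum_option, hb, real_inner_comm v ζ]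
  simp only [real_inner_comm v]

theorem exists_adapted_basis {ζ : V} (hζ : ⟪ζ, ζ⟫_ℝ = 1) {e : ι → V} (he : Orthonormal ℝ e)
    (heζ : ∀ i, ⟪ζ, e i⟫_ℝ = 0) (hcard : Module.finrank ℝ V = Fintype.card ι + 1) :
    ∃ b : OrthonormalBasis (Option ι) ℝ V, b none = ζ ∧ ∀ i, b (some i) = e i := by
  classical
  have ho : Orthonormal ℝ (fun o : Option ι => o.elim ζ e) := by
    rw [orthonormal_iff_ite] at he ⊢
    rintro (_ | i) (_ | j)
    · simpa using hζ
    · simpa using heζ j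
    · simpa [real_inner_comm] using heζ i
    · simpa using he i j
  have hc : Fintype.card (Option ι) = Module.finrank ℝ V := by simp [hcard]
  refine ⟨(basisOfOrthonormalOfCardEqFinrank ho hc).toOrthonormalBasis (by simpa using ho), ?_, ?_⟩
  <;> simp

namespace IsAlmostContact

variable {φ : Module.End ℝ V} {ζ : V} (h : IsAlmostContact φ ζ)
include h

/-- `φ` maps an orthonormal basis of `ker η` to an orthonormal basis of `ker η`. -/
theorem sum_bilin_map {b : OrthonormalBasis (Option ι) ℝ V} (hb : b none = ζ)
    (B : V →ₗ[ℝ] V →ₗ[ℝ] ℝ) :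
    ∑ k, B (φ (b (some k))) (φ (b (some k))) = ∑ k, B (b (some k)) (b (some k)) := by
  classical
  have hb' : ∀ k, ⟪ζ, b (some k)⟫_ℝ = 0 := fun k => by
    rw [← hb]; exact b.orthonormal.2 (by simp)
  have ho : Orthonormal ℝ fun k => φ (b (some k)) := by
    rw [orthonormal_iff_ite]
    intro i j
    rw [h.inner_map_map, hb', hb', mul_zero, sub_zero]
    simpa using orthonormal_iff_ite.1 b.orthonormal (some i) (some j)
  obtain ⟨b', hn, hs⟩ := exists_adapted_basis h.inner_self ho (fun i => h.inner_map _)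
    (by simpa using Module.finrank_eq_card_basis b.toBasis)
  have := sum_bilin_eq b' b B
  simp only [Fintype.sum_option, hn, hs, hb] at this
  linarith

end IsAlmostContact

end FrameSums

section Algebra

variable {V : Type*} [NormedAddCommGroup V] [InnerProductSpace ℝ V]
  {κ ι : Type*} [Fintype κ] [Fintype ι]

/-- The bilinear map `(u, v) ↦ [ξ u, ξ v]`. -/
def lieTensor (ξ : V →ₗ[ℝ] Module.End ℝ V) : V →ₗ[ℝ] V →ₗ[ℝ] Module.End ℝ V :=
  LinearMap.mk₂ ℝ (fun u v => ξ u * ξ v - ξ v * ξ u)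
    (by intro u u' v; simp only [map_add, add_mul, mul_add]; abel)
    (by intro c u v; simp only [map_smul, smul_mul_assoc, mul_smul_comm, smul_sub])
    (by intro u v v'; simp only [map_add, add_mul, mul_add]; abel)
    (by intro c u v; simp only [map_smul, smul_mul_assoc, mul_smul_comm, smul_sub])

theorem lieTensor_apply (ξ : V →ₗ[ℝ] Module.End ℝ V) (u v : V) :
    lieTensor ξ u v = ⁅ξ u, ξ v⁆ := rfl

namespace IsAlmostContact

variable {φ : Module.End ℝ V} {ζ : V} (h : IsAlmostContact φ ζ)
include h

theorem inner_perpFormula (A : Module.End ℝ V) (v w : V) :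
    ⟪perpFormula φ ζ A v, w⟫_ℝ = (1 / 2) * (⟪A v, w⟫_ℝ - ⟪A (φ v), φ w⟫_ℝ
      + ⟪ζ, A v⟫_ℝ * ⟪ζ, w⟫_ℝ + ⟪ζ, v⟫_ℝ * ⟪A ζ, w⟫_ℝ) := by
  simp only [perpFormula_apply, inner_add_left, real_inner_smul_left]
  rw [h.skew (A (φ v))]
  ring

/-- The trace of the `u(n)^⊥`-component of a curvature-like tensor `T`. -/
theorem sum_inner_perpFormula (T : V →ₗ[ℝ] V →ₗ[ℝ] Module.End ℝ V) (hT : ∀ u v, T u v ∈ so V)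
    (hanti : ∀ u v, T u v = -T v u) (b : OrthonormalBasis κ ℝ V) :
    ∑ i, ∑ j, ⟪perpFormula φ ζ (T (b i) (b j)) (b j), b i⟫_ℝ =
      (1 / 2) * (∑ i, ∑ j, ⟪T (b i) (b j) (b j), b i⟫_ℝ
        - ∑ i, ∑ j, ⟪T (b i) (b j) (φ (b j)), φ (b i)⟫_ℝ)
      + ∑ j, ⟪T ζ (b j) (b j), ζ⟫_ℝ := by
  have hexp : ∀ L : V →ₗ[ℝ] ℝ, ∑ i, ⟪ζ, b i⟫_ℝ * L (b i) = L ζ := fun L => by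
    conv_rhs => rw [← b.sum_repr' ζ]
    simp [real_inner_comm ζ]
  have h1 : ∑ i, ∑ j, ⟪ζ, T (b i) (b j) (b j)⟫_ℝ * ⟪ζ, b i⟫_ℝ = ∑ j, ⟪T ζ (b j) (b j), ζ⟫_ℝ := by
    rw [Finset.sum_comm]
    refine Finset.sum_congr rfl fun j _ => ?_
    rw [real_inner_comm ζ]
    simpa [mul_comm] using hexp ((innerSL ℝ ζ).toLinearMap ∘ₗ (T.flip (b j)).flip (b j))
  have h2 : ∑ i, ∑ j, ⟪ζ, b j⟫_ℝ * ⟪T (b i) (b j) ζ, b i⟫_ℝ = ∑ j, ⟪T ζ (b j) (b j), ζ⟫_ℝ := by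
    refine Finset.sum_congr rfl fun i _ => ?_
    have := hexp ((innerSL ℝ (b i)).toLinearMap ∘ₗ (T (b i)).flip ζ)
    simp only [LinearMap.comp_apply, LinearMap.flip_apply, ContinuousLinearMap.coe_coe,
      innerSL_apply_apply] at this
    simp only [real_inner_comm (b i)] at this ⊢
    rw [this, hanti, LinearMap.neg_apply, inner_neg_right, real_inner_comm, hT, neg_neg,
      real_inner_comm]
  simp only [h.inner_perpFormula, ← Finset.mul_sum, Finset.sum_add_distrib,
    Finset.sum_sub_distrib, h1, h2]
  ring

theorem sum_inner_lie_perpFormula (ξ : V →ₗ[ℝ] Module.End ℝ V) [FiniteDimensional ℝ V]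
    (hξ : ∀ v, ξ v ∈ unitaryPerp φ ζ) {b : OrthonormalBasis (Option ι) ℝ V} (hb : b none = ζ)
    {e : ι → V} (he : ∀ i, b (some i) = e i) :
    ∑ i, ∑ j, ⟪perpFormula φ ζ ⁅ξ (b i), ξ (b j)⁆ (b j), b i⟫_ℝ =
      (1 / 2) * ((∑ i, ∑ j, ⟪ξ (e i) (e j), ζ⟫_ℝ * ⟪ξ (e j) (e i), ζ⟫_ℝ)
        - (∑ i, ∑ j, ⟪ξ (e i) (e i), ζ⟫_ℝ * ⟪ξ (e j) (e j), ζ⟫_ℝ)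
        + (∑ i, ∑ j, ⟪ξ (e i) (e j), ζ⟫_ℝ * ⟪ξ (φ (e j)) (φ (e i)), ζ⟫_ℝ)
        + (∑ i, ∑ j, ⟪ξ (e i) (φ (e i)), ζ⟫_ℝ * ⟪ξ (e j) (φ (e j)), ζ⟫_ℝ))
      + 2 * ((∑ j, ∑ k, ⟪ξ ζ (e j), e k⟫_ℝ * ⟪ξ (e j) ζ, e k⟫_ℝ)
        - (∑ i, ∑ k, ⟪ξ (e i) (e i), e k⟫_ℝ * ⟪ξ ζ ζ, e k⟫_ℝ)) := by
  have hs : ∀ v, ξ v ∈ so V := fun v => (hξ v).1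
  have hζe : ∀ i, ⟪ζ, e i⟫_ℝ = 0 := fun i => by
    rw [← hb, ← he]; exact b.orthonormal.2 (by simp)
  have hz : ∀ u, ⟪ξ u ζ, ζ⟫_ℝ = 0 := fun u => inner_self_of_mem_so (hs u) ζ
  have pars : ∀ u v : V, ⟪u, v⟫_ℝ = ⟪u, ζ⟫_ℝ * ⟪v, ζ⟫_ℝ + ∑ k, ⟪u, e k⟫_ℝ * ⟪v, e k⟫_ℝ := by
    simpa only [he] using parseval_option hb
  have reidx : ∀ B : V →ₗ[ℝ] V →ₗ[ℝ] ℝ, ∑ k, B (φ (e k)) (φ (e k)) = ∑ k, B (e k) (e k) := by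
    simpa only [he] using fun B => h.sum_bilin_map hb B
  have mulB : ∀ u v : V, ∑ k, ⟪u, φ (e k)⟫_ℝ * ⟪v, φ (e k)⟫_ℝ = ∑ k, ⟪u, e k⟫_ℝ * ⟪v, e k⟫_ℝ :=
    fun u v => reidx (LinearMap.mk₂ ℝ (fun w w' => ⟪u, w⟫_ℝ * ⟪v, w'⟫_ℝ)
      (by simp [inner_add_right, add_mul]) (by simp [real_inner_smul_right, mul_assoc])
      (by simp [inner_add_right, mul_add])
      (by simp [real_inner_smul_right, mul_left_comm]))
  have anti : ∀ u i k, ⟪ξ u (φ (e i)), φ (e k)⟫_ℝ = -⟪ξ u (e i), e k⟫_ℝ := fun u i k =>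
    h.inner_perp_map_map (hξ u) _ _ (hζe i) (hζe k)
  set H : V := ∑ i, ξ (e i) (e i) with hH
  set K : V := ∑ i, ξ (e i) (φ (e i)) with hK
  have hHH : ⟪H, H⟫_ℝ = (∑ i, ∑ j, ⟪ξ (e i) (e i), ζ⟫_ℝ * ⟪ξ (e j) (e j), ζ⟫_ℝ)
      + ∑ k, ⟪H, e k⟫_ℝ * ⟪H, e k⟫_ℝ := by
    rw [pars H H, ← Finset.sum_mul_sum, hH, sum_inner]
  have hKk : ∀ k, ⟪K, φ (e k)⟫_ℝ = -⟪H, e k⟫_ℝ := fun k => by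
    simp only [hH, hK, sum_inner, anti, Finset.sum_neg_distrib]
  have hKK : ⟪K, K⟫_ℝ = (∑ i, ∑ j, ⟪ξ (e i) (φ (e i)), ζ⟫_ℝ * ⟪ξ (e j) (φ (e j)), ζ⟫_ℝ)
      + ∑ k, ⟪H, e k⟫_ℝ * ⟪H, e k⟫_ℝ := by
    rw [pars K K, ← mulB K K]
    simp only [hKk, neg_mul_neg]
    rw [← Finset.sum_mul_sum, hK, sum_inner]
  have h17 : (∑ i, ∑ k, ⟪ξ (e i) (e i), e k⟫_ℝ * ⟪ξ ζ ζ, e k⟫_ℝ) = ⟪H, ξ ζ ζ⟫_ℝ := by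
    rw [pars H, hz, mul_zero, zero_add, Finset.sum_comm]
    simp only [← Finset.sum_mul, hH, sum_inner]
  have h7 : (∑ j, ∑ k, ⟪ξ ζ (e j), e k⟫_ℝ * ⟪ξ (e j) ζ, e k⟫_ℝ) =
      ∑ j, ⟪ξ ζ (e j), ξ (e j) ζ⟫_ℝ := by
    refine Finset.sum_congr rfl fun j _ => ?_
    rw [pars (ξ ζ (e j)), hz, mul_zero, zero_add]
  have pars2 : ∀ F G : ι → ι → V, ∑ i, ∑ j, ⟪F i j, G i j⟫_ℝ =
      (∑ i, ∑ j, ⟪F i j, ζ⟫_ℝ * ⟪G i j, ζ⟫_ℝ)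
      + ∑ i, ∑ j, ∑ k, ⟪F i j, e k⟫_ℝ * ⟪G i j, e k⟫_ℝ := fun F G => by
    rw [← Finset.sum_add_distrib]
    refine Finset.sum_congr rfl fun i _ => ?_
    rw [← Finset.sum_add_distrib]
    exact Finset.sum_congr rfl fun j _ => pars _ _
  have hQ := pars2 (fun i j => ξ (e i) (e j)) (fun i j => ξ (e j) (e i))
  have h12 : ∀ i, ∑ j, ⟪ξ (e i) (e j), ζ⟫_ℝ * ⟪ξ (φ (e j)) (φ (e i)), ζ⟫_ℝ =
      -∑ j, ⟪ξ (e i) (φ (e j)), ζ⟫_ℝ * ⟪ξ (e j) (φ (e i)), ζ⟫_ℝ := fun i => by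
    have := reidx (LinearMap.mk₂ ℝ
      (fun w w' => ⟪ξ (e i) w, ζ⟫_ℝ * ⟪ξ (φ w') (φ (e i)), ζ⟫_ℝ)
      (by simp [inner_add_left, add_mul]) (by simp [real_inner_smul_left, mul_assoc])
      (by simp [inner_add_left, mul_add]) (by simp [real_inner_smul_left, mul_left_comm]))
    simp only [LinearMap.mk₂_apply, h.sq, hζe, zero_smul, add_zero, map_neg, LinearMap.neg_apply,
      inner_neg_left, mul_neg, Finset.sum_neg_distrib] at this
    exact this.symm
  have hQ' : ∑ i, ∑ j, ⟪ξ (e i) (φ (e j)), ξ (e j) (φ (e i))⟫_ℝ =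
      -(∑ i, ∑ j, ⟪ξ (e i) (e j), ζ⟫_ℝ * ⟪ξ (φ (e j)) (φ (e i)), ζ⟫_ℝ)
      + ∑ i, ∑ j, ∑ k, ⟪ξ (e i) (e j), e k⟫_ℝ * ⟪ξ (e j) (e i), e k⟫_ℝ := by
    rw [pars2 (fun i j => ξ (e i) (φ (e j))) (fun i j => ξ (e j) (φ (e i)))]
    have h3 : ∀ i j, ∑ k, ⟪ξ (e i) (φ (e j)), e k⟫_ℝ * ⟪ξ (e j) (φ (e i)), e k⟫_ℝ =
        ∑ k, ⟪ξ (e i) (e j), e k⟫_ℝ * ⟪ξ (e j) (e i), e k⟫_ℝ := fun i j => by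
      rw [← mulB]
      simp only [anti, neg_mul_neg]
    simp only [h12, h3, Finset.sum_neg_distrib, neg_neg]
  have hlie : ∀ u v w w', ⟪⁅ξ u, ξ v⁆ w, w'⟫_ℝ = ⟪ξ u w, ξ v w'⟫_ℝ - ⟪ξ v w, ξ u w'⟫_ℝ := by
    intro u v w w'
    rw [Ring.lie_def, LinearMap.sub_apply, Module.End.mul_apply, Module.End.mul_apply,
      inner_sub_left, hs u, hs v (ξ u w)]
    ring
  have key := h.sum_inner_perpFormula (lieTensor ξ) (fun u v => lie_mem_so (hs u) (hs v))
    (fun u v => (neg_sub (ξ v * ξ u) (ξ u * ξ v)).symm) b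
  simp only [lieTensor_apply, hlie, Finset.sum_sub_distrib] at key
  have a1 : ∑ i, ∑ j, ⟪ξ (b j) (b j), ξ (b i) (b i)⟫_ℝ = ⟪ξ ζ ζ + H, ξ ζ ζ + H⟫_ℝ := by
    have : ξ ζ ζ + H = ∑ o, ξ (b o) (b o) := by simp only [Fintype.sum_option, hb, he, hH]
    rw [this, sum_inner, Finset.sum_comm]
    simp only [inner_sum]
  have a2 : ∑ i, ∑ j, ⟪ξ (b j) (φ (b j)), ξ (b i) (φ (b i))⟫_ℝ = ⟪K, K⟫_ℝ := by
    have : K = ∑ o, ξ (b o) (φ (b o)) := by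
      simp only [Fintype.sum_option, hb, he, hK, h.map_zeta, map_zero, zero_add]
    rw [this, sum_inner, Finset.sum_comm]
    simp only [inner_sum]
  have a3 : ∑ i, ∑ j, ⟪ξ (b i) (b j), ξ (b j) (b i)⟫_ℝ = ⟪ξ ζ ζ, ξ ζ ζ⟫_ℝ
      + 2 * (∑ j, ⟪ξ ζ (e j), ξ (e j) ζ⟫_ℝ) + ∑ i, ∑ j, ⟪ξ (e i) (e j), ξ (e j) (e i)⟫_ℝ := by
    simp only [Fintype.sum_option, hb, he, Finset.sum_add_distrib]
    simp only [fun i => real_inner_comm (ξ ζ (e i)) (ξ (e i) ζ)]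
    ring
  have a4 : ∑ i, ∑ j, ⟪ξ (b i) (φ (b j)), ξ (b j) (φ (b i))⟫_ℝ =
      ∑ i, ∑ j, ⟪ξ (e i) (φ (e j)), ξ (e j) (φ (e i))⟫_ℝ := by
    simp [Fintype.sum_option, hb, he, h.map_zeta]
  have a5 : ∑ j, ⟪ξ ζ (b j), ξ (b j) ζ⟫_ℝ = ⟪ξ ζ ζ, ξ ζ ζ⟫_ℝ
      + ∑ j, ⟪ξ ζ (e j), ξ (e j) ζ⟫_ℝ := by
    simp only [Fintype.sum_option, hb, he]
  have a6 : ∑ j, ⟪ξ (b j) (b j), ξ ζ ζ⟫_ℝ = ⟪ξ ζ ζ, ξ ζ ζ⟫_ℝ + ⟪H, ξ ζ ζ⟫_ℝ := by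
    simp only [Fintype.sum_option, hb, he, hH, sum_inner]
  rw [a1, a2, a3, a4, a5, a6, inner_add_left, inner_add_right, inner_add_right, hQ, hQ', hKK, hHH,
    real_inner_comm (ξ ζ ζ) H] at key
  rw [h7, h17, key, real_inner_comm (ξ ζ ζ) H]
  ring

end IsAlmostContact

end Algebra

section Commutator

variable {E : Type*} [NormedAddCommGroup E] [NormedSpace ℝ E] [CompleteSpace E]
  {H : Type*} [TopologicalSpace H] {I : ModelWithCorners ℝ E H} [I.Boundaryless]
  {M : Type*} [TopologicalSpace M] [ChartedSpace H M] [IsManifold I ∞ M]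

open VectorField Filter Topology

omit [CompleteSpace E] [I.Boundaryless] [IsManifold I ∞ M] in
theorem mvfderiv_congr {f g : M → ℝ} {x : M} (h : f =ᶠ[𝓝 x] g) :
    mvfderiv I f x = mvfderiv I g x :=
  h.mfderiv_eq (I := I) (I' := 𝓘(ℝ, ℝ))

omit [CompleteSpace E] [I.Boundaryless] in
theorem mvfderiv_comp_extChartAt {g : E → ℝ} {x y : M} (hy : y ∈ (extChartAt I x).source)
    (hg : DifferentiableAt ℝ g (extChartAt I x y)) (v : TangentSpace I y) :
    mvfderiv I (fun z => g (extChartAt I x z)) y v =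
      fderiv ℝ g (extChartAt I x y) (mfderiv I 𝓘(ℝ, E) (extChartAt I x) y v) := by
  have h := mvfderiv_comp_apply (I' := I) (I := 𝓘(ℝ, E)) (g := g) y hg.mdifferentiableAt
    (mdifferentiableAt_extChartAt (I := I) (x := x) (by simpa using hy)) v
  refine h.trans ?_
  rw [mvfderiv, mfderiv_eq_fderiv]
  rfl

omit [CompleteSpace E] [I.Boundaryless] in
theorem mfderiv_extChartAt_vectorField {x y : M} (hy : y ∈ (extChartAt I x).source)
    (X : Π y : M, TangentSpace I y) :
    mfderiv I 𝓘(ℝ, E) (extChartAt I x) y (X y) =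
      mpullbackWithin 𝓘(ℝ, E) I (extChartAt I x).symm X (Set.range I) (extChartAt I x y) := by
  have A : (extChartAt I x).symm (extChartAt I x y) = y := (extChartAt I x).left_inv hy
  have h : X y = mpullback I 𝓘(ℝ, E) (extChartAt I x)
      (mpullbackWithin 𝓘(ℝ, E) I (extChartAt I x).symm X (Set.range I)) y := by
    rw [mpullback_apply, mpullbackWithin_apply,
      ← (isInvertible_mfderiv_extChartAt hy).inverse_comp_apply_of_right,
      mfderivWithin_extChartAt_symm_comp_mfderiv_extChartAt' hy, A]
    simp only [ContinuousLinearMap.inverse_id, ContinuousLinearMap.coe_id', id_eq]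
  rw [eq_comm, mpullback_apply, (isInvertible_mfderiv_extChartAt hy).inverse_apply_eq] at h
  exact h.symm

omit [CompleteSpace E] in
theorem contDiffAt_comp_extChartAt_symm {f : M → ℝ} {x y : M} {n : ℕ∞}
    (hy : y ∈ (extChartAt I x).source) (hf : CMDiffAt n f y) :
    ContDiffAt ℝ n (f ∘ (extChartAt I x).symm) (extChartAt I x y) := by
  have hs : CMDiffAt n (extChartAt I x).symm (extChartAt I x y) :=
    ((contMDiffOn_extChartAt_symm (n := ∞) x).contMDiffAt
      ((isOpen_extChartAt_target x).mem_nhds ((extChartAt I x).map_source hy))).of_le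
      (by exact_mod_cast le_top)
  refine contMDiffAt_iff_contDiffAt.1 (ContMDiffAt.comp _ ?_ hs)
  rwa [(extChartAt I x).left_inv hy]

omit [CompleteSpace E] in
theorem eventually_mvfderiv_eq {f : M → ℝ} {x : M} (hf : CMDiffAt 1 f x)
    (X : Π y : M, TangentSpace I y) :
    ∀ᶠ y in 𝓝 x, mvfderiv I f y (X y) =
      fderiv ℝ (f ∘ (extChartAt I x).symm) (extChartAt I x y)
        (mpullbackWithin 𝓘(ℝ, E) I (extChartAt I x).symm X (Set.range I) (extChartAt I x y)) := by
  filter_upwards [extChartAt_source_mem_nhds (I := I) x,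
    (contMDiffAt_iff_contMDiffAt_nhds (by simp)).1 hf] with y hy hfy
  have hd : DifferentiableAt ℝ (f ∘ (extChartAt I x).symm) (extChartAt I x y) :=
    (contDiffAt_comp_extChartAt_symm (n := 1) hy hfy).differentiableAt (by simp)
  have he : f =ᶠ[𝓝 y] fun z => (f ∘ (extChartAt I x).symm) (extChartAt I x z) := by
    filter_upwards [(isOpen_extChartAt_source (I := I) x).mem_nhds hy] with z hz
    exact (congrArg f ((extChartAt I x).left_inv hz)).symm
  rw [mvfderiv_congr he, mvfderiv_comp_extChartAt hy hd, mfderiv_extChartAt_vectorField hy]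

/-- The derivation along the Lie bracket is the commutator of the derivations. -/
theorem mvfderiv_mlieBracket {f : M → ℝ} {x : M} (hf : CMDiffAt 2 f x)
    {X Y : Π y : M, TangentSpace I y} (hX : MDiffAt (T% X) x) (hY : MDiffAt (T% Y) x) :
    mvfderiv I f x (mlieBracket I X Y x) =
      mvfderiv I (fun y => mvfderiv I f y (Y y)) x (X x) -
        mvfderiv I (fun y => mvfderiv I f y (X y)) x (Y x) := by
  have hx := mem_extChartAt_source (I := I) x
  have hr : Set.range I = Set.univ := I.range_eq_univ
  have hF : ContDiffAt ℝ 2 (f ∘ (extChartAt I x).symm) (extChartAt I x x) :=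
    contDiffAt_comp_extChartAt_symm (n := 2) hx hf
  have hpull : ∀ {Z : Π y : M, TangentSpace I y}, MDiffAt (T% Z) x → DifferentiableAt ℝ
      (mpullbackWithin 𝓘(ℝ, E) I (extChartAt I x).symm Z (Set.range I)) (extChartAt I x x) := by
    intro Z hZ
    have := MDifferentiableWithinAt.differentiableWithinAt_mpullbackWithin_vectorField
      (I := I) (s := Set.univ) hZ.mdifferentiableWithinAt
    rw [show (extChartAt I x).symm ⁻¹' Set.univ ∩ Set.range I = Set.univ by simp [hr]] at this
    exact differentiableWithinAt_univ.1 this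
  have hsnd : ∀ {Z : Π y : M, TangentSpace I y}, MDiffAt (T% Z) x → ∀ v : TangentSpace I x,
      mvfderiv I (fun y => mvfderiv I f y (Z y)) x v =
        fderiv ℝ (fun z => fderiv ℝ (f ∘ (extChartAt I x).symm) z
          (mpullbackWithin 𝓘(ℝ, E) I (extChartAt I x).symm Z (Set.range I) z)) (extChartAt I x x)
          (mfderiv I 𝓘(ℝ, E) (extChartAt I x) x v) := by
    intro Z hZ v
    rw [mvfderiv_congr (eventually_mvfderiv_eq (hf.of_le (by norm_num)) Z)]
    exact mvfderiv_comp_extChartAt (g := fun z => fderiv ℝ (f ∘ (extChartAt I x).symm) z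
      (mpullbackWithin 𝓘(ℝ, E) I (extChartAt I x).symm Z (Set.range I) z)) hx
      (((hF.fderiv_right (m := 1) (by norm_num)).differentiableAt (by simp)).clm_apply (hpull hZ)) v
  have hbr : mfderiv I 𝓘(ℝ, E) (extChartAt I x) x (mlieBracket I X Y x) =
      lieBracket ℝ (mpullbackWithin 𝓘(ℝ, E) I (extChartAt I x).symm X (Set.range I))
        (mpullbackWithin 𝓘(ℝ, E) I (extChartAt I x).symm Y (Set.range I)) (extChartAt I x x) := by
    have h : mlieBracket I X Y x = _ := mlieBracketWithin_apply (s := Set.univ)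
    have hs : (extChartAt I x).symm ⁻¹' Set.univ ∩ Set.range I = Set.univ := by simp [hr]
    rw [hs] at h
    refine ((isInvertible_mfderiv_extChartAt hx).inverse_apply_eq.1 h.symm).symm.trans ?_
    exact congrFun (lieBracketWithin_univ (𝕜 := ℝ) (E := E)) _
  rw [(eventually_mvfderiv_eq (hf.of_le (by norm_num)) (mlieBracket I X Y)).self_of_nhds,
    hsnd hX, hsnd hY, ← mfderiv_extChartAt_vectorField hx, hbr,
    mfderiv_extChartAt_vectorField hx, mfderiv_extChartAt_vectorField hx]
  exact fderiv_apply_lieBracket hF (by simp) (hpull hY) (hpull hX)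

end Commutator

section Curvature

variable {E : Type*} [NormedAddCommGroup E] [NormedSpace ℝ E] [FiniteDimensional ℝ E]
  {H : Type*} [TopologicalSpace H] {I : ModelWithCorners ℝ E H}
  {M : Type*} [TopologicalSpace M] [T2Space M] [ChartedSpace H M] [IsManifold I ∞ M]

open VectorField Filter Topology

/-- The local extension of a tangent vector agrees near `x` with a globally smooth vector field. -/
theorem exists_contMDiff_eventuallyEq {x : M} (w : TangentSpace I x) :
    ∃ W : Π y : M, TangentSpace I y, ContMDiff I (I.prod 𝓘(ℝ, E)) ∞ (T% W) ∧
      ∀ᶠ y in 𝓝 x, W y = FiberBundle.extend E w y := by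
  obtain ⟨s, hs, hsw⟩ := FiberBundle.exists_contMDiffOn_extend (k := ∞) I E w
  obtain ⟨u, hus, hu, hxu⟩ := mem_nhds_iff.1 hs
  obtain ⟨ψ, -, hψ⟩ := (SmoothBumpFunction.nhds_basis_tsupport (I := I) x).mem_iff.1
    (hu.mem_nhds hxu)
  refine ⟨(ψ : M → ℝ) • FiberBundle.extend E w,
    ψ.contMDiff.contMDiffOn.smul_section_of_tsupport hu hψ (hsw.mono hus), ?_⟩
  filter_upwards [ψ.eventuallyEq_one] with y hy
  simp [hy]

omit [FiniteDimensional ℝ E] [T2Space M] in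
theorem eventually_mdifferentiableAt_extend {x : M} (u : TangentSpace I x) :
    ∀ᶠ y in 𝓝 x, MDiffAt (T% (FiberBundle.extend E u)) y := by
  obtain ⟨s, hs, hsu⟩ := FiberBundle.exists_mdifferentiableOn_extend I E u
  filter_upwards [eventually_mem_nhds_iff.2 hs] with y hy
  exact (hsu y (mem_of_mem_nhds hy)).mdifferentiableAt hy

theorem mdifferentiableAt_covariantDerivative
    {D : CovariantDerivative I E (fun x : M => TangentSpace I x)}
    (hD : D.ContMDiffCovariantDerivative ∞) {x : M} (w : TangentSpace I x)
    {Y : Π y : M, TangentSpace I y} (hY : MDiffAt (T% Y) x) :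
    MDiffAt (T% (fun y => D (FiberBundle.extend E w) y (Y y))) x := by
  obtain ⟨W, hW, hWw⟩ := exists_contMDiff_eventuallyEq w
  have h1 : MDiffAt (T% (fun y => D W y (Y y))) x :=
    MDifferentiableAt.clm_bundle_apply (F₁ := E) (F₂ := E)
      (((hD.contMDiff.contMDiff (σ := W) (by simpa using hW.contMDiffOn)).contMDiffAt
        (by simp)).mdifferentiableAt (by simp)) hY
  refine h1.congr_of_eventuallyEq ?_
  filter_upwards [eventually_eventually_nhds.2 hWw,
    eventually_mdifferentiableAt_extend w] with y hy hy2
  have := D.isCovariantDerivativeOnUniv.congr_of_eventuallyEq hy2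
    ((hW y).mdifferentiableAt (by simp)) Filter.univ_mem (hy.mono fun _ h => h.symm)
  simp only [TotalSpace.mk_inj]
  exact congrArg (fun A => A (Y y)) this

end Curvature

section CurvatureTensor

variable {E : Type*} [NormedAddCommGroup E] [NormedSpace ℝ E] [FiniteDimensional ℝ E]
  {H : Type*} [TopologicalSpace H] {I : ModelWithCorners ℝ E H}
  {M : Type*} [TopologicalSpace M] [T2Space M] [ChartedSpace H M] [IsManifold I ∞ M]

open VectorField Filter Topology

omit [FiniteDimensional ℝ E] [T2Space M] in
theorem extend_eq_symmₗ {x y : M} (hy : y ∈ (trivializationAt E (TangentSpace I) x).baseSet)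
    (u : TangentSpace I x) :
    FiberBundle.extend E u y =
      (trivializationAt E (TangentSpace I) x).symmₗ ℝ y
        ((trivializationAt E (TangentSpace I) x).linearMapAt ℝ x u) := by
  rw [Trivialization.symmₗ_apply _ hy, Trivialization.coe_linearMapAt_of_mem _
    (FiberBundle.mem_baseSet_trivializationAt' x)]
  rfl

omit [FiniteDimensional ℝ E] [T2Space M] in
theorem extend_add_eventuallyEq {x : M} (u v : TangentSpace I x) :
    ∀ᶠ y in 𝓝 x, FiberBundle.extend E (u + v) y =
      (FiberBundle.extend E u + FiberBundle.extend E v) y := by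
  filter_upwards [(trivializationAt E (TangentSpace I) x).open_baseSet.mem_nhds
    (FiberBundle.mem_baseSet_trivializationAt' x)] with y hy
  simp only [extend_eq_symmₗ hy, Pi.add_apply, map_add]

omit [FiniteDimensional ℝ E] [T2Space M] in
theorem extend_smul_eventuallyEq {x : M} (c : ℝ) (u : TangentSpace I x) :
    ∀ᶠ y in 𝓝 x, FiberBundle.extend E (c • u) y = (c • FiberBundle.extend E u) y := by
  filter_upwards [(trivializationAt E (TangentSpace I) x).open_baseSet.mem_nhds
    (FiberBundle.mem_baseSet_trivializationAt' x)] with y hy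
  simp only [extend_eq_symmₗ hy, Pi.smul_apply, map_smul]

omit [FiniteDimensional ℝ E] [T2Space M] in
theorem curvatureField_swap (D : CovariantDerivative I E (fun x : M => TangentSpace I x))
    (X Y Z : Π x : M, TangentSpace I x) (x : M) :
    curvatureField D X Y Z x = -curvatureField D Y X Z x := by
  rw [curvatureField, curvatureField, mlieBracket_swap_apply, map_neg]
  abel

theorem curvatureField_congr_left {D : CovariantDerivative I E (fun x : M => TangentSpace I x)}
    (hD : D.ContMDiffCovariantDerivative ∞) {x : M} (w : TangentSpace I x)
    {X X' Y : Π x : M, TangentSpace I x} (hX : MDiffAt (T% X) x) (hX' : MDiffAt (T% X') x)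
    (h : ∀ᶠ y in 𝓝 x, X y = X' y) :
    curvatureField D X Y (FiberBundle.extend E w) x =
      curvatureField D X' Y (FiberBundle.extend E w) x := by
  have h1 := D.isCovariantDerivativeOnUniv.congr_of_eventuallyEq
    (mdifferentiableAt_covariantDerivative hD w hX)
    (mdifferentiableAt_covariantDerivative hD w hX') Filter.univ_mem
    (h.mono fun y hy => by rw [hy])
  have h2 : mlieBracket I X Y x = mlieBracket I X' Y x :=
    Filter.EventuallyEq.mlieBracket_vectorField_eq h (Filter.EventuallyEq.refl _ _)
  rw [curvatureField, curvatureField, h1, h2, h.self_of_nhds]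

theorem curvatureField_add_left {D : CovariantDerivative I E (fun x : M => TangentSpace I x)}
    (hD : D.ContMDiffCovariantDerivative ∞) {x : M} (w : TangentSpace I x)
    {X X' Y : Π x : M, TangentSpace I x} (hX : MDiffAt (T% X) x) (hX' : MDiffAt (T% X') x) :
    curvatureField D (X + X') Y (FiberBundle.extend E w) x =
      curvatureField D X Y (FiberBundle.extend E w) x
        + curvatureField D X' Y (FiberBundle.extend E w) x := by
  have h1 : (fun y => D (FiberBundle.extend E w) y ((X + X') y)) =
      (fun y => D (FiberBundle.extend E w) y (X y))
        + fun y => D (FiberBundle.extend E w) y (X' y) := by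
    ext y; simp
  have h2 := D.isCovariantDerivativeOnUniv.add (mdifferentiableAt_covariantDerivative hD w hX)
    (mdifferentiableAt_covariantDerivative hD w hX')
  rw [curvatureField, curvatureField, curvatureField, h1, h2, mlieBracket_add_left hX hX',
    Pi.add_apply, map_add, map_add, add_apply]
  abel

theorem curvatureField_smul_left {D : CovariantDerivative I E (fun x : M => TangentSpace I x)}
    (hD : D.ContMDiffCovariantDerivative ∞) {x : M} (w : TangentSpace I x) (c : ℝ)
    {X Y : Π x : M, TangentSpace I x} (hX : MDiffAt (T% X) x) :
    curvatureField D (c • X) Y (FiberBundle.extend E w) x =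
      c • curvatureField D X Y (FiberBundle.extend E w) x := by
  have h1 : (fun y => D (FiberBundle.extend E w) y ((c • X) y)) =
      c • fun y => D (FiberBundle.extend E w) y (X y) := by
    ext y; simp
  have h2 := D.isCovariantDerivativeOnUniv.smul_const c
    (mdifferentiableAt_covariantDerivative hD w hX)
  rw [curvatureField, curvatureField, h1, h2, mlieBracket_const_smul_left hX,
    Pi.smul_apply, map_smul, map_smul, smul_apply, smul_sub, smul_sub]

variable [RiemannianBundle (fun x : M => TangentSpace I x)]

omit [T2Space M] in
theorem curvature_frame (D : CovariantDerivative I E (fun x : M => TangentSpace I x)) (x : M)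
    (u v : TangentSpace I x) (i : Fin (Module.finrank ℝ (TangentSpace I x))) :
    curvature D x u v (frame I x i) =
      curvatureField D (FiberBundle.extend E u) (FiberBundle.extend E v)
        (FiberBundle.extend E (frame I x i)) x := by
  have := (frame I x).toBasis.constr_basis ℝ (fun i =>
    curvatureField D (FiberBundle.extend E u) (FiberBundle.extend E v)
      (FiberBundle.extend E (frame I x i)) x) i
  rwa [OrthonormalBasis.coe_toBasis] at this

omit [T2Space M] in
theorem curvature_swap (D : CovariantDerivative I E (fun x : M => TangentSpace I x)) (x : M)
    (u v : TangentSpace I x) : curvature D x u v = -curvature D x v u := by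
  refine (frame I x).toBasis.ext fun i => ?_
  rw [OrthonormalBasis.coe_toBasis, LinearMap.neg_apply, curvature_frame, curvature_frame,
    curvatureField_swap]

variable {D : CovariantDerivative I E (fun x : M => TangentSpace I x)}

theorem curvature_add_left (hs : D.ContMDiffCovariantDerivative ∞) (x : M)
    (u u' v : TangentSpace I x) :
    curvature D x (u + u') v = curvature D x u v + curvature D x u' v := by
  refine (frame I x).toBasis.ext fun i => ?_
  rw [OrthonormalBasis.coe_toBasis, LinearMap.add_apply, curvature_frame, curvature_frame,
    curvature_frame, curvatureField_congr_left hs _ (FiberBundle.mdifferentiableAt_extend I E _)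
      (mdifferentiableAt_add_section (FiberBundle.mdifferentiableAt_extend I E u)
        (FiberBundle.mdifferentiableAt_extend I E u')) (extend_add_eventuallyEq u u')]
  exact curvatureField_add_left hs _ (FiberBundle.mdifferentiableAt_extend I E u)
    (FiberBundle.mdifferentiableAt_extend I E u')

theorem curvature_smul_left (hs : D.ContMDiffCovariantDerivative ∞) (x : M) (c : ℝ)
    (u v : TangentSpace I x) : curvature D x (c • u) v = c • curvature D x u v := by
  refine (frame I x).toBasis.ext fun i => ?_
  rw [OrthonormalBasis.coe_toBasis, LinearMap.smul_apply, curvature_frame, curvature_frame,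
    curvatureField_congr_left hs _ (FiberBundle.mdifferentiableAt_extend I E _)
      (mdifferentiableAt_const (c := c) |>.smul_section
        (FiberBundle.mdifferentiableAt_extend I E u)) (extend_smul_eventuallyEq c u)]
  exact curvatureField_smul_left hs _ c (FiberBundle.mdifferentiableAt_extend I E u)

/-- The curvature tensor as a bilinear map. -/
noncomputable def curvatureTensor (hs : D.ContMDiffCovariantDerivative ∞) (x : M) :
    TangentSpace I x →ₗ[ℝ] TangentSpace I x →ₗ[ℝ] Module.End ℝ (TangentSpace I x) :=
  LinearMap.mk₂ ℝ (curvature D x) (curvature_add_left hs x) (curvature_smul_left hs x)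
    (fun u v v' => by
      rw [curvature_swap, curvature_add_left hs, neg_add, ← curvature_swap, ← curvature_swap])
    (fun c u v => by
      rw [curvature_swap, curvature_smul_left hs, ← smul_neg, ← curvature_swap])

variable [I.Boundaryless] [IsContMDiffRiemannianBundle I ∞ E (fun x : M => TangentSpace I x)]

theorem inner_curvatureField {D : CovariantDerivative I E (fun x : M => TangentSpace I x)}
    (hs : D.ContMDiffCovariantDerivative ∞) (hm : IsMetric D) {x : M} (z w : TangentSpace I x)
    {X Y : Π x : M, TangentSpace I x} (hX : MDiffAt (T% X) x) (hY : MDiffAt (T% Y) x) :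
    ⟪curvatureField D X Y (FiberBundle.extend E z) x, w⟫_ℝ =
      -⟪z, curvatureField D X Y (FiberBundle.extend E w) x⟫_ℝ := by
  set Z := FiberBundle.extend E z with hZ
  set W := FiberBundle.extend E w with hW
  have mZ : ∀ᶠ y in 𝓝 x, MDiffAt (T% Z) y := eventually_mdifferentiableAt_extend z
  have mW : ∀ᶠ y in 𝓝 x, MDiffAt (T% W) y := eventually_mdifferentiableAt_extend w
  have hf : CMDiffAt 2 (fun y => ⟪Z y, W y⟫_ℝ) x := by
    have cZ : CMDiffAt 2 (T% Z) x := FiberBundle.contMDiffAt_extend I E z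
    have cW : CMDiffAt 2 (T% W) x := FiberBundle.contMDiffAt_extend I E w
    exact ContMDiffAt.inner_bundle cZ cW
  have hsnd : ∀ {U V : Π x : M, TangentSpace I x}, MDiffAt (T% U) x → MDiffAt (T% V) x →
      mvfderiv I (fun y => mvfderiv I (fun y => ⟪Z y, W y⟫_ℝ) y (V y)) x (U x) =
        ⟪D (fun y => D Z y (V y)) x (U x), w⟫_ℝ + ⟪D Z x (V x), D W x (U x)⟫_ℝ
        + (⟪D Z x (U x), D W x (V x)⟫_ℝ + ⟪z, D (fun y => D W y (V y)) x (U x)⟫_ℝ) := by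
    intro U V hU hV
    have e : (fun y => mvfderiv I (fun y => ⟪Z y, W y⟫_ℝ) y (V y)) =ᶠ[𝓝 x]
        (fun y => ⟪D Z y (V y), W y⟫_ℝ) + fun y => ⟪Z y, D W y (V y)⟫_ℝ := by
      filter_upwards [mZ, mW] with y hZy hWy
      exact inner_rule hm hZy hWy (V y)
    have mDZ := mdifferentiableAt_covariantDerivative hs z hV
    have mDW := mdifferentiableAt_covariantDerivative hs w hV
    have m1 : MDiffAt (fun y => ⟪D Z y (V y), W y⟫_ℝ) x :=
      MDifferentiableAt.inner_bundle mDZ mW.self_of_nhds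
    have m2 : MDiffAt (fun y => ⟪Z y, D W y (V y)⟫_ℝ) x :=
      MDifferentiableAt.inner_bundle mZ.self_of_nhds mDW
    rw [mvfderiv_congr e, mvfderiv_add m1 m2, add_apply,
      inner_rule hm mDZ mW.self_of_nhds, inner_rule hm mZ.self_of_nhds mDW, hZ, hW,
      FiberBundle.extend_apply_self, FiberBundle.extend_apply_self]
  have h1 := mvfderiv_mlieBracket hf hX hY
  rw [hsnd hX hY, hsnd hY hX, inner_rule hm mZ.self_of_nhds mW.self_of_nhds] at h1
  rw [hZ, hW, FiberBundle.extend_apply_self, FiberBundle.extend_apply_self, ← hZ, ← hW] at h1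
  simp only [curvatureField, inner_sub_left, inner_sub_right]
  linarith

theorem curvature_mem_so (hs : D.ContMDiffCovariantDerivative ∞) (hm : IsMetric D) (x : M)
    (u v : TangentSpace I x) : curvature D x u v ∈ so (TangentSpace I x) := by
  let B : TangentSpace I x →ₗ[ℝ] TangentSpace I x →ₗ[ℝ] ℝ :=
    (innerₗ (TangentSpace I x)).comp (curvature D x u v)
      + (innerₗ (TangentSpace I x)).compl₂ (curvature D x u v)
  have hB : B = 0 := by
    refine (frame I x).toBasis.ext fun i => (frame I x).toBasis.ext fun j => ?_
    have := inner_curvatureField hs hm (frame I x i) (frame I x j)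
      (FiberBundle.mdifferentiableAt_extend I E u) (FiberBundle.mdifferentiableAt_extend I E v)
    rw [← curvature_frame, ← curvature_frame] at this
    simp only [OrthonormalBasis.coe_toBasis]
    change ⟪curvature D x u v (frame I x i), frame I x j⟫_ℝ
      + ⟪frame I x i, curvature D x u v (frame I x j)⟫_ℝ = 0
    linarith
  intro z w
  have : ⟪curvature D x u v z, w⟫_ℝ + ⟪z, curvature D x u v w⟫_ℝ = 0 :=
    LinearMap.congr_fun (LinearMap.congr_fun hB z) w
  linarith

end CurvatureTensor

section Pointwise

variable {E : Type*} [NormedAddCommGroup E] [NormedSpace ℝ E] [FiniteDimensional ℝ E]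
  {H : Type*} [TopologicalSpace H] {I : ModelWithCorners ℝ E H}
  {M : Type*} [TopologicalSpace M] [ChartedSpace H M] [IsManifold I ∞ M]
  [RiemannianBundle (fun x : M => TangentSpace I x)]
  [IsContMDiffRiemannianBundle I ∞ E (fun x : M => TangentSpace I x)] (S : AlmostContactMetric I M)

theorem AlmostContactMetric.isAlmostContact (x : M) :
    IsAlmostContact (S.φ x : TangentSpace I x →ₗ[ℝ] TangentSpace I x) (S.ζ x) where
  inner_self := inner_ζ_self S x
  sq v := by
    have := S.φ_sq x v
    rwa [S.dual] at this
  skew := φ_skew S x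
  map_zeta := φ_ζ S x

variable {D : CovariantDerivative I E (fun x : M => TangentSpace I x)} (hD : IsLeviCivita D)

/-- The intrinsic torsion at a point, as a linear map. -/
noncomputable def torsionTensor (x : M) :
    TangentSpace I x →ₗ[ℝ] Module.End ℝ (TangentSpace I x) where
  toFun := intrinsicTorsion S hD x
  map_add' u v := by ext w; simp [intrinsicTorsion, torsionEnd]
  map_smul' c u := by ext w; simp [intrinsicTorsion, torsionEnd]

theorem torsionTensor_mem (x : M) (v : TangentSpace I x) : torsionTensor S hD x v ∈
    unitaryPerp (S.φ x : TangentSpace I x →ₗ[ℝ] TangentSpace I x) (S.ζ x) :=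
  (gConnection_spec S hD).perp x v

variable {m : ℕ} (x : M) (e : Fin m → TangentSpace I x) (he : Orthonormal ℝ e)
  (heη : ∀ i, S.η x (e i) = 0) (hdim : Module.finrank ℝ E = m + 1)
include he heη hdim

theorem exists_frame : ∃ b : OrthonormalBasis (Option (Fin m)) ℝ (TangentSpace I x),
    b none = S.ζ x ∧ ∀ i, b (some i) = e i :=
  exists_adapted_basis (inner_ζ_self S x) he (fun i => by rw [← S.dual, heη])
    (by rw [Fintype.card_fin]; exact hdim)

theorem sAltPerp_eq :
    sAltPerp S hD x = (1 / 2) * (i8 S hD x e - i10 S hD x e + i12 S hD x e + i14 S hD x e)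
      + 2 * (i7 S hD x e - i17 S hD x e) := by
  obtain ⟨b, hb, hbe⟩ := exists_frame S x e he heη hdim
  have h := S.isAlmostContact x
  have hs := fun v => (torsionTensor_mem S hD x v).1
  refine Eq.trans ?_ ((sum_perpFormula_eq _ (S.ζ x) (lieTensor (torsionTensor S hD x))
    (frame I x) b).trans
    (h.sum_inner_lie_perpFormula (torsionTensor S hD x) (torsionTensor_mem S hD x) hb hbe))
  refine Finset.sum_congr rfl fun i _ => Finset.sum_congr rfl fun j _ => ?_
  exact congrArg (fun A => ⟪A (frame I x j), frame I x i⟫_ℝ)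
    (h.perpPart_eq (lie_mem_so (hs (frame I x i)) (hs (frame I x j))))

omit he heη hdim in
include hD in
theorem sPerp_eq [I.Boundaryless] [T2Space M] :
    sPerp D S x = (1 / 2) * (scalarCurvature D x - starScalarCurvature D S x)
      + ricci D x (S.ζ x) (S.ζ x) := by
  have h := S.isAlmostContact x
  have hso := curvature_mem_so hD.smooth hD.metric x
  refine Eq.trans ?_ (h.sum_inner_perpFormula (curvatureTensor hD.smooth x) hso
    (curvature_swap D x) (frame I x))
  refine Finset.sum_congr rfl fun i _ => Finset.sum_congr rfl fun j _ => ?_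
  rw [AlmostContactMetric.perp, h.perpPart_eq (hso _ _)]
  rfl

end Pointwise

end AlmostContact

theorem mainTheorem8 {n : ℕ} {M : Type*} [TopologicalSpace M] [T2Space M]
    [ChartedSpace (EuclideanSpace ℝ (Fin (2 * n + 1))) M]
    [IsManifold (𝓡 (2 * n + 1)) ∞ M]
    [RiemannianBundle (fun x : M => TangentSpace (𝓡 (2 * n + 1)) x)]
    [IsContMDiffRiemannianBundle (𝓡 (2 * n + 1)) ∞ (EuclideanSpace ℝ (Fin (2 * n + 1)))
      (fun x : M => TangentSpace (𝓡 (2 * n + 1)) x)]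
    (S : AlmostContact.AlmostContactMetric (𝓡 (2 * n + 1)) M)
    (D : CovariantDerivative (𝓡 (2 * n + 1)) (EuclideanSpace ℝ (Fin (2 * n + 1)))
      (fun x : M => TangentSpace (𝓡 (2 * n + 1)) x))
    (hD : AlmostContact.IsLeviCivita D)
    (x : M) (e : Fin (2 * n) → TangentSpace (𝓡 (2 * n + 1)) x)
    (he : Orthonormal ℝ e) (heη : ∀ i, S.η x (e i) = 0) :
    AlmostContact.sAltPerp S hD x =
        (1 / 2) * (AlmostContact.i8 S hD x e - AlmostContact.i10 S hD x e
          + AlmostContact.i12 S hD x e + AlmostContact.i14 S hD x e)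
        + 2 * (AlmostContact.i7 S hD x e - AlmostContact.i17 S hD x e) ∧
      AlmostContact.sPerp D S x =
        (1 / 2) * (AlmostContact.scalarCurvature D x - AlmostContact.starScalarCurvature D S x)
        + AlmostContact.ricci D x (S.ζ x) (S.ζ x) :=
  ⟨AlmostContact.sAltPerp_eq S hD x e he heη finrank_euclideanSpace_fin,
    AlmostContact.sPerp_eq S hD x⟩
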